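/- **Setting.** Let $(\overline M,\overline g)$ be a smooth Lorentzian manifold of dimension $n+2$ with Levi-Civita connection $\overline\nabla$. Let $M$ be an immersed lightlike hypersurface with induced degenerate metric $g=\langle\cdot,\cdot\rangle$, and suppose that its radical distribution $\mathrm{Rad}\,TM=TM\cap TM^{\perp}$, which has rank one, is spanned by a globally defined smooth nowhere zero vector field $\xi$. Let $S(TM)$ be a screen distribution, that is, a smooth rank-$n$ distribution with $TM=S(TM)\oplus \mathrm{Rad}\,TM$, and let $P:TM\to S(TM)$ be the corresponding projection. Let $N$ be the unique vector field along $M$ with $\overline g(N,\xi)=1$ and $\overline g(N,N)=\overline g(N,W)=0$ for all $W\in S(TM)$. Put $\eta=\overline g(N,\cdot)$, $X^\flat=g(X,\cdot)+\eta(X)\eta$, and $\tilde g(X,Y)=X^\flat(Y)$, which is a nondegenerate metric on $M$. The gradient $\nabla^g f$ is defined by $\tilde g(\nabla^g f,X)=df(X)$. Let $\nabla_XY=Q(\overline\nabla_XY)$ be the induced connection, $Q$ being the projection onto $TM$ along $\mathrm{span}\{N\}$, and let $C(X,PY)=\eta(\nabla_XPY)$. Suppose that $M$ is totally geodesic, i.e.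 $\overline\nabla_XY=\nabla_XY$ for all vector fields $X,Y$ on $M$. An $\mathcal A^\nabla$-tensor is a smooth endomorphism field $S$ of $TM$ with $PS=SP$, $\langle SX,Y\rangle=\langle X,SY\rangle$ and $X^\flat\big((\nabla_XS)X\big)=0$ for all $X,Y$. The screen distribution is totally umbilical if near every point there is a smooth function $\rho$ with $C(X,PY)=\rho\, g(X,Y)$ for all $X,Y$. A distribution $D\subset TM$ is umbilical, with mean curvature vector field $H$, if $H$ is a smooth vector field on $M$ with $\nabla_XX=p(\nabla_XX)+\langle X,X\rangle H$ for every local section $X$ of $D$, where $p:TM\to D$ is the $\tilde g$-orthogonal projection. **Proposition 6.1.** Suppose that the screen distribution is totally umbilical. Let $S$ be an $\mathcal A^\nabla$-tensor with eigenfunctions $\lambda_0,\dots,\lambda_k\in C^\infty(M)$, i.e. at each point $x$ the numbers $\lambda_0(x),\dots,\lambda_k(x)$ are pairwise different and are exactly the eigenvalues of $S_x$. Then every eigenspace distribution $D_\alpha=\mathrm{Ker}(\lambda_\alpha I-S)$, $0\le\alpha\le k$, is umbilical. Moreover there is a smooth function $\rho$ on all of $M$ with $C(X,PY)=\rho\,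 g(X,Y)$ for all $X,Y$, such that, if $D_0=\mathrm{Rad}\,TM$, then for each $1\le i\le k$ a mean curvature vector field of $D_i$ is $$\varsigma_i=-\frac12\sum_{\substack{1\le j\le k\\ j\ne i}}P_j\big(\nabla^g\ln|\lambda_i-\lambda_j|\big)+\rho\,\xi ,$$ where $P_j:TM\to D_j$ is the $\tilde g$-orthogonal projection (equivalently, the projection along the other eigenspace distributions). -/

import Mathlib

open scoped Manifold ContDiff Topology
open Bundle

namespace LightlikeGeometry

/-- The model space `ℝᵈ`. -/
abbrev Model (d : ℕ) : Type := EuclideanSpace ℝ (Fin d)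

section Basics

variable {d : ℕ} {M : Type*} [TopologicalSpace M] [ChartedSpace (Model d) M]

/-- A vector field on `M`, without any regularity. -/
abbrev VField (d : ℕ) (M : Type*) [TopologicalSpace M] [ChartedSpace (Model d) M] : Type _ :=
  ∀ x : M, TangentSpace (𝓡 d) x

/-- The vector field `X` is smooth on the set `U`. -/
def SmoothFieldOn [IsManifold (𝓡 d) ∞ M] (X : VField d M) (U : Set M) : Prop :=
  ContMDiffOn (𝓡 d) (𝓡 d).tangent ∞ (fun x => (⟨x, X x⟩ : TangentBundle (𝓡 d) M)) U

/-- The vector field `X` is differentiable at the point `x`. -/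
def DifferentiableFieldAt [IsManifold (𝓡 d) ∞ M] (X : VField d M) (x : M) : Prop :=
  MDifferentiableAt (𝓡 d) (𝓡 d).tangent (fun y => (⟨y, X y⟩ : TangentBundle (𝓡 d) M)) x

/-- A smooth distribution of rank `r`: locally it has a frame of `r` smooth vector fields. -/
def IsSmoothDistribution [IsManifold (𝓡 d) ∞ M] (r : ℕ) (D : ∀ x : M, Submodule ℝ (TangentSpace (𝓡 d) x)) : Prop :=
  ∀ x : M, ∃ U : Set M, IsOpen U ∧ x ∈ U ∧ ∃ e : Fin r → VField d M,
    (∀ i, SmoothFieldOn (e i) U) ∧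
    ∀ y ∈ U, LinearIndependent ℝ (fun i => e i y) ∧
      Submodule.span ℝ (Set.range fun i => e i y) = D y

/-- A smooth endomorphism field, that is, a smooth `(1,1)`-tensor field. -/
def SmoothEndField [IsManifold (𝓡 d) ∞ M]
    (S : ∀ x : M, TangentSpace (𝓡 d) x →L[ℝ] TangentSpace (𝓡 d) x) : Prop :=
  ContMDiff (𝓡 d) ((𝓡 d).prod 𝓘(ℝ, Model d →L[ℝ] Model d)) ∞
    (fun x => TotalSpace.mk' (Model d →L[ℝ] Model d)
      (E := fun x : M => TangentSpace (𝓡 d) x →L[ℝ] TangentSpace (𝓡 d) x) x (S x))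

end Basics

/-- A smooth Lorentzian metric on a manifold of dimension `n + 2`, signature `(-, +, …, +)`. -/
structure LorentzMetric (n : ℕ) (N : Type*) [TopologicalSpace N]
    [ChartedSpace (Model (n + 2)) N] [IsManifold (𝓡 (n + 2)) ∞ N] where
  /-- the scalar product on each tangent space -/
  val : ∀ p : N, TangentSpace (𝓡 (n + 2)) p →L[ℝ] TangentSpace (𝓡 (n + 2)) p →L[ℝ] ℝ
  symm : ∀ (p : N) (v w : TangentSpace (𝓡 (n + 2)) p), val p v w = val p w v
  smooth : ContMDiff (𝓡 (n + 2))
    ((𝓡 (n + 2)).prod 𝓘(ℝ, Model (n + 2) →L[ℝ] Model (n + 2) →L[ℝ] ℝ)) ∞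
    (fun p => TotalSpace.mk' (Model (n + 2) →L[ℝ] Model (n + 2) →L[ℝ] ℝ)
      (E := fun p : N =>
        TangentSpace (𝓡 (n + 2)) p →L[ℝ] TangentSpace (𝓡 (n + 2)) p →L[ℝ] ℝ) p (val p))
  signature : ∀ p : N, ∃ b : Module.Basis (Fin (n + 2)) ℝ (TangentSpace (𝓡 (n + 2)) p),
    ∀ i j, val p (b i) (b j) = if i = j then (if i = 0 then -1 else 1) else 0

/-- A linear connection on the tangent bundle. Mind the order of the arguments of Mathlib's
covariant derivatives: `conn Y x v` is `∇_v Y` at the point `x`, for `v` tangent at `x`. -/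
abbrev Connection (d : ℕ) (N : Type*) [TopologicalSpace N] [ChartedSpace (Model d) N]
    [IsManifold (𝓡 d) ∞ N] : Type _ :=
  CovariantDerivative (𝓡 d) (Model d) (TangentSpace (𝓡 d) : N → Type _)

/-- `conn` is the Levi-Civita connection of `gb`: it is torsion-free and metric. -/
structure IsLeviCivita {n : ℕ} {N : Type*} [TopologicalSpace N]
    [ChartedSpace (Model (n + 2)) N] [IsManifold (𝓡 (n + 2)) ∞ N]
    (gb : LorentzMetric n N) (conn : Connection (n + 2) N) : Prop where
  torsion_free : conn.torsion = 0
  metric : ∀ (Y Z : VField (n + 2) N) (p : N), DifferentiableFieldAt Y p →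
    DifferentiableFieldAt Z p → ∀ v : TangentSpace (𝓡 (n + 2)) p,
    mvfderiv (𝓡 (n + 2)) (fun q => gb.val q (Y q) (Z q)) p v
      = gb.val p (conn Y p v) (Z p) + gb.val p (Y p) (conn Z p v)

section Hypersurface

variable {n : ℕ} {N : Type*} [TopologicalSpace N]
  [ChartedSpace (Model (n + 2)) N] [IsManifold (𝓡 (n + 2)) ∞ N]
  {M : Type*} [TopologicalSpace M]
  [ChartedSpace (Model (n + 1)) M] [IsManifold (𝓡 (n + 1)) ∞ M]

/-- The differential at `x` of a map `f` from an `(n+1)`-manifold to an `(n+2)`-manifold. -/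
noncomputable def diff (f : M → N) (x : M) :
    TangentSpace (𝓡 (n + 1)) x →L[ℝ] TangentSpace (𝓡 (n + 2)) (f x) :=
  mfderiv (𝓡 (n + 1)) (𝓡 (n + 2)) f x

/-- The (possibly degenerate) metric `g = f^* gb` induced on `M`. -/
noncomputable def inducedMetric (gb : LorentzMetric n N) (f : M → N) (x : M)
    (v w : TangentSpace (𝓡 (n + 1)) x) : ℝ :=
  gb.val (f x) (diff f x v) (diff f x w)

/-- The radical `Rad T_x M = T_x M ∩ (T_x M)^⊥` of the induced metric. -/
noncomputable def radical (gb : LorentzMetric n N) (f : M → N) (x : M) :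
    Submodule ℝ (TangentSpace (𝓡 (n + 1)) x) where
  carrier := {v | ∀ w, inducedMetric gb f x v w = 0}
  add_mem' := by
    intro a b ha hb w
    have h1 := ha w
    have h2 := hb w
    simp only [inducedMetric] at h1 h2 ⊢
    simp [h1, h2]
  zero_mem' := by
    intro w
    simp [inducedMetric]
  smul_mem' := by
    intro c a ha w
    have h1 := ha w
    simp only [inducedMetric] at h1 ⊢
    simp [h1]

variable (n N M) in
/-- A lightlike hypersurface `(M, g, S(TM))` of a Lorentzian manifold `(N, gb)`, immersed by `f`,
with a screen distribution `S(TM)` and a globally defined smooth nowhere zero section `ξ` of the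
radical distribution `Rad TM`. -/
structure LightlikeHypersurface where
  /-- the Lorentzian metric of the ambient manifold -/
  gb : LorentzMetric n N
  /-- the immersion of the hypersurface -/
  f : M → N
  immersion : Manifold.IsImmersion (𝓡 (n + 1)) (𝓡 (n + 2)) ∞ f
  /-- the global null vector field -/
  ξ : VField (n + 1) M
  ξ_smooth : SmoothFieldOn ξ Set.univ
  ξ_ne_zero : ∀ x, ξ x ≠ 0
  ξ_mem_radical : ∀ x, ξ x ∈ radical gb f x
  /-- the screen distribution -/
  screen : ∀ x : M, Submodule ℝ (TangentSpace (𝓡 (n + 1)) x)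
  screen_smooth : IsSmoothDistribution n screen
  screen_isCompl : ∀ x, IsCompl (screen x) (radical gb f x)

namespace LightlikeHypersurface

variable (L : LightlikeHypersurface n N M)

/-- The induced degenerate metric `g` on `M`. -/
noncomputable def g (x : M) (v w : TangentSpace (𝓡 (n + 1)) x) : ℝ :=
  inducedMetric L.gb L.f x v w

/-- The projection `P : TM → S(TM)` with respect to `TM = S(TM) ⊕ Rad TM`. -/
noncomputable def P (x : M) :
    TangentSpace (𝓡 (n + 1)) x →ₗ[ℝ] TangentSpace (𝓡 (n + 1)) x :=
  Submodule.projection (L.screen x) (radical L.gb L.f x) (L.screen_isCompl x)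

/-- The lightlike transversal vector field along `M`: `trans x` is the unique vector `V` of
`T_{f x} N` with `gb(V, ξ) = 1`, `gb(V, V) = 0` and `gb(V, W) = 0` for all `W` in `S(TM)`. -/
noncomputable def trans (x : M) : TangentSpace (𝓡 (n + 2)) (L.f x) :=
  Classical.epsilon fun V =>
    L.gb.val (L.f x) V (diff L.f x (L.ξ x)) = 1 ∧ L.gb.val (L.f x) V V = 0 ∧
      ∀ w ∈ L.screen x, L.gb.val (L.f x) V (diff L.f x w) = 0

/-- The one-form `η = gb(trans, ·)`. -/
noncomputable def η (x : M) (v : TangentSpace (𝓡 (n + 1)) x) : ℝ :=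
  L.gb.val (L.f x) (L.trans x) (diff L.f x v)

/-- `flat x v w` is `v^♭(w) = g(v, w) + η(v) η(w)`. As a function of `v` and `w` this is also the
associated nondegenerate metric `g̃(v, w)`. -/
noncomputable def flat (x : M) (v w : TangentSpace (𝓡 (n + 1)) x) : ℝ :=
  L.g x v w + L.η x v * L.η x w

/-- The gradient of `φ` with respect to the degenerate metric: the unique vector `v` at `x` such
that `g̃(v, w) = dφ(w)` for all `w`. -/
noncomputable def grad (φ : M → ℝ) : VField (n + 1) M := fun x =>
  Classical.epsilon fun v => ∀ w, L.flat x v w = mvfderiv (𝓡 (n + 1)) φ x w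

/-- The projection onto a subspace `D` of `T_x M` that is orthogonal for `g̃`. -/
noncomputable def proj (x : M) (D : Submodule ℝ (TangentSpace (𝓡 (n + 1)) x))
    (u : TangentSpace (𝓡 (n + 1)) x) : TangentSpace (𝓡 (n + 1)) x :=
  Classical.epsilon fun q => q ∈ D ∧ ∀ w ∈ D, L.flat x (u - q) w = 0

/-- The projection `Q : T N|_M → TM` with respect to `T N|_M = TM ⊕ tr(TM)`, where `tr(TM)` is
spanned by the lightlike transversal vector field. -/
noncomputable def Q (x : M) (w : TangentSpace (𝓡 (n + 2)) (L.f x)) :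
    TangentSpace (𝓡 (n + 1)) x :=
  Classical.epsilon fun v => w - diff L.f x v ∈ Submodule.span ℝ {L.trans x}

/-- A vector field `Z` on `N` extends the vector field `Y` of `M` near `x`. -/
def IsLocalExtension (Y : VField (n + 1) M) (x : M) (Z : VField (n + 2) N) : Prop :=
  DifferentiableFieldAt Z (L.f x) ∧ ∀ᶠ y in 𝓝 x, Z (L.f y) = diff L.f y (Y y)

variable (conn : Connection (n + 2) N)

/-- The derivative of `Y` in the direction `v ∈ T_x M` with respect to the connection of `N`: the
ambient derivative of any extension of `Y` to `N` near `x`. -/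
noncomputable def ambientDeriv (Y : VField (n + 1) M) (x : M)
    (v : TangentSpace (𝓡 (n + 1)) x) : TangentSpace (𝓡 (n + 2)) (L.f x) :=
  conn (Classical.epsilon fun Z : VField (n + 2) N => L.IsLocalExtension Y x Z) (L.f x)
    (diff L.f x v)

/-- The connection induced on `M`: `nabla conn Y x v` is `∇_v Y = Q(∇̄_v Y)`. -/
noncomputable def nabla (Y : VField (n + 1) M) (x : M) (v : TangentSpace (𝓡 (n + 1)) x) :
    TangentSpace (𝓡 (n + 1)) x :=
  L.Q x (L.ambientDeriv conn Y x v)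

/-- The second fundamental form `h(v, Y) = ∇̄_v Y - ∇_v Y` of the hypersurface. -/
noncomputable def secondForm (Y : VField (n + 1) M) (x : M)
    (v : TangentSpace (𝓡 (n + 1)) x) : TangentSpace (𝓡 (n + 2)) (L.f x) :=
  L.ambientDeriv conn Y x v - diff L.f x (L.nabla conn Y x v)

/-- `M` is totally geodesic: its second fundamental form vanishes. -/
def IsTotallyGeodesic : Prop :=
  ∀ (U : Set M) (Y : VField (n + 1) M), IsOpen U → SmoothFieldOn Y U →
    ∀ x ∈ U, ∀ v, L.secondForm conn Y x v = 0

/-- `C(v, PY) = gb(∇_v (PY), trans)`, the local second fundamental form of the screen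
distribution. -/
noncomputable def C (Y : VField (n + 1) M) (x : M) (v : TangentSpace (𝓡 (n + 1)) x) : ℝ :=
  L.η x (L.nabla conn (fun y => L.P y (Y y)) x v)

/-- `C(X, PY) = ρ g(X, Y)` on the open set `U`. -/
def ScreenUmbilicOn (ρ : M → ℝ) (U : Set M) : Prop :=
  ∀ (V : Set M) (Y : VField (n + 1) M), IsOpen V → V ⊆ U → SmoothFieldOn Y V →
    ∀ x ∈ V, ∀ v, L.C conn Y x v = ρ x * L.g x v (Y x)

/-- The screen distribution is totally umbilical: around each point there is a smooth function `ρ`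
such that `C(X, PY) = ρ g(X, Y)`. -/
def ScreenTotallyUmbilical : Prop :=
  ∀ x : M, ∃ U : Set M, IsOpen U ∧ x ∈ U ∧ ∃ ρ : M → ℝ,
    ContMDiffOn (𝓡 (n + 1)) 𝓘(ℝ, ℝ) ∞ ρ U ∧ L.ScreenUmbilicOn conn ρ U

/-- `∇S(X, Y) = (∇_X S) Y = ∇_X (S Y) - S (∇_X Y)` at the point `x`. -/
noncomputable def nablaEnd
    (S : ∀ x : M, TangentSpace (𝓡 (n + 1)) x →L[ℝ] TangentSpace (𝓡 (n + 1)) x)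
    (X Y : VField (n + 1) M) (x : M) : TangentSpace (𝓡 (n + 1)) x :=
  L.nabla conn (fun y => S y (Y y)) x (X x) - S x (L.nabla conn Y x (X x))

/-- `S` is an `A^∇`-tensor on `(M, g, S(TM))`: a smooth endomorphism field of `TM` that preserves
the screen, is `g`-symmetric, and satisfies `X^♭(∇S(X, X)) = 0` for all `X`. -/
structure IsATensor
    (S : ∀ x : M, TangentSpace (𝓡 (n + 1)) x →L[ℝ] TangentSpace (𝓡 (n + 1)) x) : Prop where
  smooth : SmoothEndField S
  screen_preserving : ∀ x v, L.P x (S x v) = S x (L.P x v)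
  symm : ∀ x v w, L.g x (S x v) w = L.g x v (S x w)
  cyclic : ∀ (U : Set M) (X : VField (n + 1) M), IsOpen U → SmoothFieldOn X U →
    ∀ x ∈ U, L.flat x (X x) (L.nablaEnd conn S X X x) = 0

/-- The vector field `H` is a mean curvature vector field of the distribution `D`: it is smooth and
`∇_X X = p(∇_X X) + g(X, X) H` for all local smooth sections `X` of `D`, where `p` is the
orthogonal projection onto `D`. -/
def IsMeanCurvature (D : ∀ x : M, Submodule ℝ (TangentSpace (𝓡 (n + 1)) x))
    (H : VField (n + 1) M) : Prop :=
  SmoothFieldOn H Set.univ ∧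
    ∀ (U : Set M) (X : VField (n + 1) M), IsOpen U → SmoothFieldOn X U → (∀ y ∈ U, X y ∈ D y) →
      ∀ x ∈ U, L.nabla conn X x (X x)
        = L.proj x (D x) (L.nabla conn X x (X x)) + L.g x (X x) (X x) • H x

/-- The distribution `D` is umbilical. -/
def IsUmbilical (D : ∀ x : M, Submodule ℝ (TangentSpace (𝓡 (n + 1)) x)) : Prop :=
  ∃ H : VField (n + 1) M, L.IsMeanCurvature conn D H

end LightlikeHypersurface

/-- The eigenspace distribution `Ker(S - α I)` of an endomorphism field `S` and a function `α`. -/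
noncomputable def eigenDistribution
    (S : ∀ x : M, TangentSpace (𝓡 (n + 1)) x →L[ℝ] TangentSpace (𝓡 (n + 1)) x) (α : M → ℝ)
    (x : M) : Submodule ℝ (TangentSpace (𝓡 (n + 1)) x) :=
  Module.End.eigenspace (S x).toLinearMap (α x)

/-- The functions `ev 0, …, ev k` are the eigenfunctions of `S`: they are smooth, and at each point
`x` their values are pairwise different and are exactly the eigenvalues of `S` at `x`. -/
structure IsEigenfunctions {k : ℕ}
    (S : ∀ x : M, TangentSpace (𝓡 (n + 1)) x →L[ℝ] TangentSpace (𝓡 (n + 1)) x)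
    (ev : Fin (k + 1) → M → ℝ) : Prop where
  smooth : ∀ a, ContMDiff (𝓡 (n + 1)) 𝓘(ℝ, ℝ) ∞ (ev a)
  distinct : ∀ x a b, ev a x = ev b x → a = b
  hasEigenvalue_iff : ∀ (x : M) (μ : ℝ),
    Module.End.HasEigenvalue (S x).toLinearMap μ ↔ ∃ a, ev a x = μ

end Hypersurface

end LightlikeGeometry

/-! Since `M` is totally geodesic, `∇` is the restriction of the ambient Levi-Civita connection, so
it is compatible with `g` (`mvfderiv_g`). The metric `g` is positive semidefinite with kernel
spanned by `ξ`, hence `g̃` is positive definite. The tensor `S` preserves the screen and the line of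
`ξ`, so it is `g̃`-symmetric. Its eigenspaces therefore span `TM` and are mutually orthogonal, and
Lagrange polynomials in `S` give smooth projections onto them.

Polarizing `X^♭((∇_X S)X) = 0` and inserting sections `X` of `D_a` and `Z` of `D_b`, where `g(X, Z)
= 0`, yields `eigen_sections_identity`: `(λ_a - λ_b)(2 g(∇_X X, Z) + η(∇_X X) η(Z) - η(∇_X Z) η(X))
+ Z(λ_a) g̃(X, X) = 0`. The unpolarized condition gives `X(λ_a) = 0`.

If `ξ` is not in `D_a`, then `X` lies in the screen. For screen-valued `Z` the `η` terms vanish, and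
`Z(λ_b) = 0` turns the identity into `g(∇_X X, Z) = -½ g(X, X) Z(ln|λ_a - λ_b|)`
(`flat_nabla_self`). Umbilicity of the screen supplies the remaining component `η(∇_X X) = ρ g(X,
X)`. Every component of `∇_X X` normal to `D_a` is thus `g(X, X)` times a fixed vector.

If `ξ` lies in `D_a`, the identity with `X = ξ` and umbilicity give `Z(λ_a) = 0` for `Z` in the
other eigenspaces (`mvfderiv_eigenfunction_xi`). Then `∇_X X` has no normal component, and the zero
field serves as mean curvature.

The index of the eigenspace containing `ξ` is only locally constant, and that eigenspace may be
larger than the radical. The general mean curvature field is therefore glued from the two cases, and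
simplified to the stated formula when the radical is an eigenspace. -/

namespace LightlikeGeometry

/-! ### Linear algebra of Lorentzian and semidefinite scalar products -/

section Lorentz

variable {m : ℕ} {V : Type*} [AddCommGroup V] [Module ℝ V]

/-- The value of a Lorentzian scalar product in an orthonormal basis. -/
theorem lorentz_eq_sum {B : V →ₗ[ℝ] V →ₗ[ℝ] ℝ} {b : Module.Basis (Fin (m + 1)) ℝ V}
    (hb : ∀ i j, B (b i) (b j) = if i = j then (if i = 0 then -1 else 1) else 0) (v w : V) :
    B v w = -(b.repr v 0 * b.repr w 0) + ∑ i : Fin m, b.repr v i.succ * b.repr w i.succ := by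
  conv_lhs => rw [← b.sum_repr v, ← b.sum_repr w]
  simp only [map_sum, map_smul, LinearMap.sum_apply, LinearMap.smul_apply, hb, smul_eq_mul,
    mul_ite, mul_zero]
  rw [Fin.sum_univ_succ]
  simp [Fin.succ_ne_zero, mul_comm]

/-- A Lorentzian scalar product represents every linear functional. -/
theorem lorentz_exists_represent {B : V →ₗ[ℝ] V →ₗ[ℝ] ℝ} {b : Module.Basis (Fin (m + 1)) ℝ V}
    (hb : ∀ i j, B (b i) (b j) = if i = j then (if i = 0 then -1 else 1) else 0)
    (φ : V →ₗ[ℝ] ℝ) : ∃ v, ∀ w, B v w = φ w := by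
  refine ⟨∑ i, ((if i = 0 then -1 else 1) * φ (b i)) • b i, fun w => ?_⟩
  have : B (∑ i, ((if i = 0 then -1 else 1) * φ (b i)) • b i) = φ := by
    refine b.ext fun j => ?_
    simp only [map_sum, map_smul, LinearMap.sum_apply, LinearMap.smul_apply, hb, smul_eq_mul,
      mul_ite, mul_zero, Finset.sum_ite_eq', Finset.mem_univ, if_true]
    split_ifs <;> simp
  rw [this]

/-- A Lorentzian scalar product is nondegenerate. -/
theorem lorentz_nondegenerate {B : V →ₗ[ℝ] V →ₗ[ℝ] ℝ} {b : Module.Basis (Fin (m + 1)) ℝ V}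
    (hb : ∀ i j, B (b i) (b j) = if i = j then (if i = 0 then -1 else 1) else 0)
    {v : V} (hv : ∀ w, B v w = 0) : v = 0 := by
  refine b.ext_elem fun j => ?_
  have h : B v (b j) = (if j = 0 then -1 else 1) * b.repr v j := by
    conv_lhs => rw [← b.sum_repr v]
    simp only [map_sum, map_smul, LinearMap.sum_apply, LinearMap.smul_apply, hb, smul_eq_mul,
      mul_ite, mul_zero, Finset.sum_ite_eq', Finset.mem_univ, if_true]
    split_ifs <;> simp
  rw [hv] at h
  split_ifs at h <;> simp <;> linarith

/-- The orthogonal complement of a null vector in a Lorentzian space is positive semidefinite. -/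
theorem lorentz_nonneg_of_orthogonal_null {B : V →ₗ[ℝ] V →ₗ[ℝ] ℝ}
    {b : Module.Basis (Fin (m + 1)) ℝ V}
    (hb : ∀ i j, B (b i) (b j) = if i = j then (if i = 0 then -1 else 1) else 0)
    {u w : V} (hu : u ≠ 0) (huu : B u u = 0) (huw : B u w = 0) : 0 ≤ B w w := by
  rw [lorentz_eq_sum hb] at huu huw ⊢
  set u0 := b.repr u 0
  set w0 := b.repr w 0
  -- Cauchy–Schwarz for the spatial parts. Nullity of `u` and orthogonality to `w` express two of
  -- its three sums through `u0` and `w0`, and `u0 ≠ 0` can then be cancelled.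
  have hcs := Finset.sum_mul_sq_le_sq_mul_sq Finset.univ (fun i : Fin m => b.repr u i.succ)
    (fun i : Fin m => b.repr w i.succ)
  simp only [sq] at hcs
  have hne : u0 ≠ 0 := by
    intro h0
    have hs : ∑ i : Fin m, b.repr u i.succ * b.repr u i.succ = 0 := by
      rw [h0] at huu; simpa using huu
    rw [Finset.sum_eq_zero_iff_of_nonneg fun i _ => mul_self_nonneg _] at hs
    refine hu (b.ext_elem fun j => ?_)
    rw [map_zero, Finsupp.zero_apply]
    refine Fin.cases h0 (fun i => ?_) j
    exact mul_self_eq_zero.1 (hs i (Finset.mem_univ _))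
  have h1 : ∑ i : Fin m, b.repr u i.succ * b.repr u i.succ = u0 * u0 := by linarith
  have h2 : ∑ i : Fin m, b.repr u i.succ * b.repr w i.succ = u0 * w0 := by linarith
  rw [h1, h2] at hcs
  have hpos : 0 < u0 * u0 := mul_self_pos.2 hne
  have : (u0 * u0) * (w0 * w0) ≤ (u0 * u0) * ∑ i : Fin m, b.repr w i.succ * b.repr w i.succ := by
    linarith
  have := le_of_mul_le_mul_left this hpos
  linarith

/-- In a positive semidefinite space every isotropic vector lies in the radical. -/
theorem eq_zero_of_isotropic_of_nonneg {B : V →ₗ[ℝ] V →ₗ[ℝ] ℝ} (hsymm : ∀ v w, B v w = B w v)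
    (hB : ∀ v, 0 ≤ B v v) {v : V} (hv : B v v = 0) (w : V) : B v w = 0 := by
  by_contra hne
  -- The coefficient is chosen so that this vector has square `-1`.
  have h := hB (w - ((B w w + 1) / (2 * B v w)) • v)
  simp only [map_sub, map_smul, LinearMap.sub_apply, LinearMap.smul_apply, smul_eq_mul, hv,
    hsymm w v] at h
  have : (B w w + 1) / (2 * B v w) * B v w = (B w w + 1) / 2 := by field_simp
  linarith

end Lorentz

/-! ### Immersions: local left inverses and injective differentials -/

section Immersion

variable {n : ℕ} {N : Type*} [TopologicalSpace N] [ChartedSpace (Model (n + 2)) N]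
  {M : Type*} [TopologicalSpace M] [ChartedSpace (Model (n + 1)) M]

/-- An immersion has a local left inverse that is differentiable at the image of the point. -/
theorem exists_local_retraction {f : M → N}
    (hf : Manifold.IsImmersion (𝓡 (n + 1)) (𝓡 (n + 2)) ∞ f) (x : M) :
    ∃ r : N → M, MDifferentiableAt (𝓡 (n + 2)) (𝓡 (n + 1)) r (f x) ∧
      ∀ᶠ y in 𝓝 x, r (f y) = y := by
  have h := hf.isImmersionAt x
  -- In adapted charts the immersion is `u ↦ (u, 0)`, so the first coordinate gives the left
  -- inverse.
  have key : ∀ y ∈ h.domChart.source, h.codChart (f y) = h.equiv (h.domChart y, 0) := by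
    intro y hy
    have hy' : h.domChart y ∈ (h.domChart.extend (𝓡 (n + 1))).target := by
      simpa using h.domChart.map_source hy
    have := h.writtenInCharts hy'
    simpa [h.domChart.left_inv hy] using this
  refine ⟨fun q => h.domChart.symm (h.equiv.symm (h.codChart q)).1, ?_, ?_⟩
  · have h1 : MDifferentiableAt (𝓡 (n + 2)) 𝓘(ℝ, Model (n + 2)) h.codChart (f x) :=
      ((contMDiffOn_of_mem_maximalAtlas h.codChart_mem_maximalAtlas).contMDiffAt
        (h.codChart.open_source.mem_nhds h.mem_codChart_source)).mdifferentiableAt (by simp)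
    have h2 : MDifferentiableAt 𝓘(ℝ, Model (n + 2)) 𝓘(ℝ, Model (n + 1))
        (fun z => (h.equiv.symm z).1) (h.codChart (f x)) := by
      apply DifferentiableAt.mdifferentiableAt
      fun_prop
    have h3 : MDifferentiableAt 𝓘(ℝ, Model (n + 1)) (𝓡 (n + 1)) h.domChart.symm
        (h.equiv.symm (h.codChart (f x))).1 := by
      have hx : (h.equiv.symm (h.codChart (f x))).1 = h.domChart x := by
        rw [key x h.mem_domChart_source]; simp
      rw [hx]
      exact ((contMDiffOn_symm_of_mem_maximalAtlas h.domChart_mem_maximalAtlas).contMDiffAt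
        (h.domChart.open_target.mem_nhds (h.domChart.map_source h.mem_domChart_source))
        ).mdifferentiableAt (by simp)
    have h4 := h2.comp (f x) h1
    exact MDifferentiableAt.comp (f x) h3 h4
  · filter_upwards [h.domChart.open_source.mem_nhds h.mem_domChart_source] with y hy
    rw [key y hy]
    simp [h.domChart.left_inv hy]

/-- The differential of an immersion is injective. -/
theorem diff_injective {f : M → N} (hf : Manifold.IsImmersion (𝓡 (n + 1)) (𝓡 (n + 2)) ∞ f)
    (x : M) : Function.Injective (diff (n := n) f x) := by
  obtain ⟨r, hr, hrf⟩ := exists_local_retraction hf x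
  have hfx : MDifferentiableAt (𝓡 (n + 1)) (𝓡 (n + 2)) f x :=
    (hf.contMDiff x).mdifferentiableAt (by simp)
  have h1 : mfderiv (𝓡 (n + 1)) (𝓡 (n + 1)) (r ∘ f) x
      = (mfderiv (𝓡 (n + 2)) (𝓡 (n + 1)) r (f x)).comp (mfderiv (𝓡 (n + 1)) (𝓡 (n + 2)) f x) :=
    mfderiv_comp x hr hfx
  have h2 : mfderiv (𝓡 (n + 1)) (𝓡 (n + 1)) (r ∘ f) x
      = mfderiv (𝓡 (n + 1)) (𝓡 (n + 1)) (id : M → M) x :=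
    Filter.EventuallyEq.mfderiv_eq (hrf.mono fun y hy => hy)
  intro v w hvw
  have hv : ∀ v, (mfderiv (𝓡 (n + 2)) (𝓡 (n + 1)) r (f x)) (diff f x v) = v := by
    intro v
    have := congrArg (fun T => T v) (h1.symm.trans h2)
    rw [mfderiv_id] at this
    exact this
  rw [← hv v, hvw, hv w]

end Immersion
-- Smooth vector fields
section SmoothFields

variable {d : ℕ} {M : Type*} [TopologicalSpace M] [ChartedSpace (Model d) M]
  [IsManifold (𝓡 d) ∞ M]

theorem SmoothFieldOn.mono {X : VField d M} {U V : Set M} (h : SmoothFieldOn X U) (hVU : V ⊆ U) :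
    SmoothFieldOn X V := ContMDiffOn.mono h hVU

theorem SmoothFieldOn.congr {X Y : VField d M} {U : Set M} (h : SmoothFieldOn X U)
    (hXY : ∀ x ∈ U, Y x = X x) : SmoothFieldOn Y U :=
  ContMDiffOn.congr h fun x hx => by simp only [hXY x hx]

theorem SmoothFieldOn.add {X Y : VField d M} {U : Set M} (hX : SmoothFieldOn X U)
    (hY : SmoothFieldOn Y U) : SmoothFieldOn (fun x => X x + Y x) U :=
  ContMDiffOn.add_section hX hY

theorem SmoothFieldOn.sub {X Y : VField d M} {U : Set M} (hX : SmoothFieldOn X U)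
    (hY : SmoothFieldOn Y U) : SmoothFieldOn (fun x => X x - Y x) U :=
  ContMDiffOn.sub_section hX hY

theorem SmoothFieldOn.smul {φ : M → ℝ} {X : VField d M} {U : Set M}
    (hφ : ContMDiffOn (𝓡 d) 𝓘(ℝ, ℝ) ∞ φ U) (hX : SmoothFieldOn X U) :
    SmoothFieldOn (fun x => φ x • X x) U :=
  ContMDiffOn.smul_section hφ hX

theorem SmoothFieldOn.sum {ι : Type*} {s : Finset ι} {X : ι → VField d M} {U : Set M}
    (hX : ∀ i ∈ s, SmoothFieldOn (X i) U) : SmoothFieldOn (fun x => ∑ i ∈ s, X i x) U :=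
  ContMDiffOn.sum_section hX

theorem SmoothFieldOn.endField
    {S : ∀ x : M, TangentSpace (𝓡 d) x →L[ℝ] TangentSpace (𝓡 d) x} (hS : SmoothEndField S)
    {X : VField d M} {U : Set M} (hX : SmoothFieldOn X U) : SmoothFieldOn (fun x => S x (X x)) U :=
  ContMDiffOn.clm_bundle_apply (F₁ := Model d) (F₂ := Model d)
    (E₁ := fun x : M => TangentSpace (𝓡 d) x) (E₂ := fun x : M => TangentSpace (𝓡 d) x)
    (b := fun x : M => x) (ϕ := S) hS.contMDiffOn hX

/-- Every tangent vector is the value of a vector field that is differentiable at the point. -/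
theorem exists_differentiableFieldAt (x : M) (v : TangentSpace (𝓡 d) x) :
    ∃ Z : VField d M, DifferentiableFieldAt Z x ∧ Z x = v := by
  refine ⟨FiberBundle.extend (Model d) v, ?_, by simp⟩
  exact FiberBundle.mdifferentiableAt_extend (𝓡 d) (Model d) v

/-- A vector field that is smooth near a point does not vanish near the point if it does not
vanish at the point. -/
theorem SmoothFieldOn.eventually_ne_zero {X : VField d M} {U : Set M} (hX : SmoothFieldOn X U)
    (hU : IsOpen U) {x : M} (hx : x ∈ U) (h0 : X x ≠ 0) : ∀ᶠ y in 𝓝 x, X y ≠ 0 := by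
  have h1 := (ContMDiffOn.contMDiffAt hX (hU.mem_nhds hx))
  rw [contMDiffAt_section] at h1
  set e := trivializationAt (Model d) (TangentSpace (𝓡 d) : M → Type _) x
  have hxe : x ∈ e.baseSet := FiberBundle.mem_baseSet_trivializationAt' x
  have h3 : ∀ y ∈ e.baseSet, (e ⟨y, X y⟩).2 = 0 ↔ X y = 0 := fun y hy =>
    (e.continuousLinearEquivAt ℝ y hy).map_eq_zero_iff
  have h2 : (e ⟨x, X x⟩).2 ≠ 0 := fun h => h0 ((h3 x hxe).1 h)
  filter_upwards [h1.continuousAt.eventually_ne h2, e.open_baseSet.mem_nhds hxe] with y hy hye h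
  exact hy ((h3 y hye).2 h)

end SmoothFields

/-! ### Extension of fields and functions from the hypersurface -/

section Hypersurface

variable {n : ℕ} {N : Type*} [TopologicalSpace N]
  [ChartedSpace (Model (n + 2)) N] [IsManifold (𝓡 (n + 2)) ∞ N]
  {M : Type*} [TopologicalSpace M]
  [ChartedSpace (Model (n + 1)) M] [IsManifold (𝓡 (n + 1)) ∞ M]

theorem LorentzMetric.mdifferentiableAt (gb : LorentzMetric n N) {Y Z : VField (n + 2) N} {p : N}
    (hY : DifferentiableFieldAt Y p) (hZ : DifferentiableFieldAt Z p) :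
    MDifferentiableAt (𝓡 (n + 2)) 𝓘(ℝ, ℝ) (fun q => gb.val q (Y q) (Z q)) p := by
  have : MDifferentiableAt (𝓡 (n + 2)) ((𝓡 (n + 2)).prod 𝓘(ℝ, ℝ))
      (fun m ↦ TotalSpace.mk' ℝ (E := Bundle.Trivial N ℝ) m (gb.val m (Y m) (Z m))) p := by
    apply MDifferentiableAt.clm_bundle_apply₂ (F₁ := Model (n + 2)) (F₂ := Model (n + 2))
      (E₁ := fun x : N => TangentSpace (𝓡 (n + 2)) x)
      (E₂ := fun x : N => TangentSpace (𝓡 (n + 2)) x)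
    · exact (gb.smooth p).mdifferentiableAt (by simp)
    · exact hY
    · exact hZ
  rw [mdifferentiableAt_totalSpace] at this
  exact this.2

theorem LorentzMetric.eq_zero (gb : LorentzMetric n N) {p : N} {v : TangentSpace (𝓡 (n + 2)) p}
    (hv : ∀ w, gb.val p v w = 0) : v = 0 := by
  obtain ⟨b, hb⟩ := gb.signature p
  exact lorentz_nondegenerate (B := (ContinuousLinearMap.coeLM ℝ).comp (gb.val p).toLinearMap)
    (b := b) hb hv

namespace LightlikeHypersurface

variable (L : LightlikeHypersurface n N M)

/-- The image of a smooth vector field under the differential of the immersion. -/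
theorem contMDiffOn_diff {Y : VField (n + 1) M} {U : Set M} (hY : SmoothFieldOn Y U) :
    ContMDiffOn (𝓡 (n + 1)) (𝓡 (n + 2)).tangent ∞
      (fun y => (⟨L.f y, diff L.f y (Y y)⟩ : TangentBundle (𝓡 (n + 2)) N)) U :=
  (ContMDiff.contMDiff_tangentMap L.immersion.contMDiff (m := ∞) (by simp)).comp_contMDiffOn hY

theorem contMDiffOn_g {Y Z : VField (n + 1) M} {U : Set M} (hY : SmoothFieldOn Y U)
    (hZ : SmoothFieldOn Z U) :
    ContMDiffOn (𝓡 (n + 1)) 𝓘(ℝ, ℝ) ∞ (fun x => L.g x (Y x) (Z x)) U := by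
  intro x hx
  have : ContMDiffWithinAt (𝓡 (n + 1)) ((𝓡 (n + 2)).prod 𝓘(ℝ, ℝ)) ∞
      (fun m ↦ TotalSpace.mk' ℝ (E := Bundle.Trivial N ℝ) (L.f m)
        (L.gb.val (L.f m) (diff L.f m (Y m)) (diff L.f m (Z m)))) U x := by
    apply ContMDiffWithinAt.clm_bundle_apply₂ (F₁ := Model (n + 2)) (F₂ := Model (n + 2))
      (E₁ := fun x : N => TangentSpace (𝓡 (n + 2)) x)
      (E₂ := fun x : N => TangentSpace (𝓡 (n + 2)) x)
    · exact (L.gb.smooth.contMDiffAt).comp_contMDiffWithinAt x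
        (L.immersion.contMDiff x).contMDiffWithinAt
    · exact L.contMDiffOn_diff hY x hx
    · exact L.contMDiffOn_diff hZ x hx
  rw [contMDiffWithinAt_totalSpace] at this
  exact this.2

/-- A smooth vector field of the hypersurface has a local extension to the ambient manifold. -/
theorem exists_isLocalExtension {Y : VField (n + 1) M} {U : Set M} (hU : IsOpen U)
    (hY : SmoothFieldOn Y U) {x : M} (hx : x ∈ U) : ∃ Z, L.IsLocalExtension Y x Z := by
  obtain ⟨r, hr, hrf⟩ := exists_local_retraction L.immersion x
  set e := trivializationAt (Model (n + 2)) (TangentSpace (𝓡 (n + 2)) : N → Type _) (L.f x) with he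
  have hxe : L.f x ∈ e.baseSet := FiberBundle.mem_baseSet_trivializationAt' _
  set w : M → Model (n + 2) := fun y => (e ⟨L.f y, diff L.f y (Y y)⟩).2 with hw
  have hwx : MDifferentiableAt (𝓡 (n + 1)) 𝓘(ℝ, Model (n + 2)) w x := by
    have h := ((L.contMDiffOn_diff hY).contMDiffAt (hU.mem_nhds hx)).mdifferentiableAt
      (by simp)
    rw [mdifferentiableAt_totalSpace] at h
    exact h.2
  have hrx : r (L.f x) = x := hrf.self_of_nhds
  -- The components of the field in a trivialization are pulled back along the retraction `r`.
  refine ⟨fun q => e.symm q (w (r q)), ?_, ?_⟩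
  · unfold DifferentiableFieldAt
    rw [mdifferentiableAt_section]
    have h1 : MDifferentiableAt (𝓡 (n + 2)) 𝓘(ℝ, Model (n + 2)) (fun q => w (r q)) (L.f x) :=
      MDifferentiableAt.comp (L.f x) (g := w) (by rw [hrx]; exact hwx) hr
    refine h1.congr_of_eventuallyEq ?_
    filter_upwards [e.open_baseSet.mem_nhds hxe] with q hq
    rw [← he, e.apply_mk_symm hq]
  · have hcont : ContinuousAt L.f x := (L.immersion.contMDiff x).continuousAt
    filter_upwards [hrf, hcont.preimage_mem_nhds (e.open_baseSet.mem_nhds hxe)] with y hy hye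
    simp only [hy, hw]
    exact e.symm_apply_apply_mk hye _

/-- A smooth function on the hypersurface extends locally to the ambient manifold. -/
theorem exists_function_extension {φ : M → ℝ} {x : M}
    (hφ : MDifferentiableAt (𝓡 (n + 1)) 𝓘(ℝ, ℝ) φ x) :
    ∃ Φ : N → ℝ, MDifferentiableAt (𝓡 (n + 2)) 𝓘(ℝ, ℝ) Φ (L.f x) ∧
      ∀ᶠ y in 𝓝 x, Φ (L.f y) = φ y := by
  obtain ⟨r, hr, hrf⟩ := exists_local_retraction L.immersion x
  have hrx : r (L.f x) = x := hrf.self_of_nhds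
  refine ⟨fun q => φ (r q), MDifferentiableAt.comp (L.f x) (g := φ) (by rw [hrx]; exact hφ) hr, ?_⟩
  filter_upwards [hrf] with y hy
  rw [hy]

/-- The chain rule for a function on the ambient manifold. -/
theorem mvfderiv_diff {Φ : N → ℝ} {φ : M → ℝ} {x : M}
    (hΦ : MDifferentiableAt (𝓡 (n + 2)) 𝓘(ℝ, ℝ) Φ (L.f x))
    (h : ∀ᶠ y in 𝓝 x, Φ (L.f y) = φ y) (v : TangentSpace (𝓡 (n + 1)) x) :
    mvfderiv (𝓡 (n + 2)) Φ (L.f x) (diff L.f x v) = mvfderiv (𝓡 (n + 1)) φ x v := by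
  have h1 := mvfderiv_comp_apply x hΦ ((L.immersion.contMDiff x).mdifferentiableAt (by simp)) v
  have h2 : mfderiv (𝓡 (n + 1)) 𝓘(ℝ, ℝ) (Φ ∘ L.f) x = mfderiv (𝓡 (n + 1)) 𝓘(ℝ, ℝ) φ x :=
    Filter.EventuallyEq.mfderiv_eq h
  refine h1.symm.trans ?_
  change mfderiv (𝓡 (n + 1)) 𝓘(ℝ, ℝ) (Φ ∘ L.f) x v = mfderiv (𝓡 (n + 1)) 𝓘(ℝ, ℝ) φ x v
  rw [h2]
  rfl

end LightlikeHypersurface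
end Hypersurface
-- The induced connection
section Hypersurface

variable {n : ℕ} {N : Type*} [TopologicalSpace N]
  [ChartedSpace (Model (n + 2)) N] [IsManifold (𝓡 (n + 2)) ∞ N]
  {M : Type*} [TopologicalSpace M]
  [ChartedSpace (Model (n + 1)) M] [IsManifold (𝓡 (n + 1)) ∞ M]

namespace LightlikeHypersurface

variable {L : LightlikeHypersurface n N M} {conn : Connection (n + 2) N}

theorem g_add_left (x : M) (u v w : TangentSpace (𝓡 (n + 1)) x) :
    L.g x (u + v) w = L.g x u w + L.g x v w := by simp [g, inducedMetric]

theorem g_add_right (x : M) (u v w : TangentSpace (𝓡 (n + 1)) x) :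
    L.g x u (v + w) = L.g x u v + L.g x u w := by simp [g, inducedMetric]

theorem g_smul_left (x : M) (c : ℝ) (v w : TangentSpace (𝓡 (n + 1)) x) :
    L.g x (c • v) w = c * L.g x v w := by simp [g, inducedMetric]

theorem g_smul_right (x : M) (c : ℝ) (v w : TangentSpace (𝓡 (n + 1)) x) :
    L.g x v (c • w) = c * L.g x v w := by simp [g, inducedMetric]

theorem g_comm (x : M) (v w : TangentSpace (𝓡 (n + 1)) x) : L.g x v w = L.g x w v :=
  L.gb.symm _ _ _

theorem IsLocalExtension.add {Y₁ Y₂ : VField (n + 1) M} {x : M} {Z₁ Z₂ : VField (n + 2) N}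
    (h₁ : L.IsLocalExtension Y₁ x Z₁) (h₂ : L.IsLocalExtension Y₂ x Z₂) :
    L.IsLocalExtension (fun y => Y₁ y + Y₂ y) x (Z₁ + Z₂) := by
  refine ⟨mdifferentiableAt_add_section h₁.1 h₂.1, ?_⟩
  filter_upwards [h₁.2, h₂.2] with y hy₁ hy₂
  simp [hy₁, hy₂]

theorem IsLocalExtension.sub {Y₁ Y₂ : VField (n + 1) M} {x : M} {Z₁ Z₂ : VField (n + 2) N}
    (h₁ : L.IsLocalExtension Y₁ x Z₁) (h₂ : L.IsLocalExtension Y₂ x Z₂) :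
    L.IsLocalExtension (fun y => Y₁ y - Y₂ y) x (Z₁ - Z₂) := by
  refine ⟨mdifferentiableAt_sub_section h₁.1 h₂.1, ?_⟩
  filter_upwards [h₁.2, h₂.2] with y hy₁ hy₂
  simp [hy₁, hy₂]

theorem IsLocalExtension.smul {φ : M → ℝ} {Y : VField (n + 1) M} {x : M} {Φ : N → ℝ}
    {Z : VField (n + 2) N} (hΦ : MDifferentiableAt (𝓡 (n + 2)) 𝓘(ℝ, ℝ) Φ (L.f x))
    (h : ∀ᶠ y in 𝓝 x, Φ (L.f y) = φ y) (hZ : L.IsLocalExtension Y x Z) :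
    L.IsLocalExtension (fun y => φ y • Y y) x (Φ • Z) := by
  refine ⟨MDifferentiableAt.smul_section hΦ hZ.1, ?_⟩
  filter_upwards [h, hZ.2] with y hy₁ hy₂
  simp [hy₁, hy₂]

/-- The derivative along the hypersurface of a field that vanishes along the hypersurface. -/
theorem conn_eq_zero (hconn : IsLeviCivita L.gb conn) {x : M} {W : VField (n + 2) N}
    (hW : DifferentiableFieldAt W (L.f x)) (h0 : ∀ᶠ y in 𝓝 x, W (L.f y) = 0)
    (v : TangentSpace (𝓡 (n + 1)) x) : conn W (L.f x) (diff L.f x v) = 0 := by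
  -- By metric compatibility, pairing the derivative of `W` with `Z` gives the derivative of `gb(W,
  -- Z)` minus a term containing `W`. Both vanish because `W = 0` along the hypersurface.
  refine L.gb.eq_zero fun w => ?_
  obtain ⟨Z, hZ, rfl⟩ := exists_differentiableFieldAt (L.f x) w
  have h := hconn.metric W Z (L.f x) hW hZ (diff L.f x v)
  rw [L.mvfderiv_diff (φ := fun _ => 0) (L.gb.mdifferentiableAt hW hZ)
    (h0.mono fun y hy => by simp [hy]), mvfderiv_const, h0.self_of_nhds] at h
  simpa using h.symm

theorem conn_eq_conn (hconn : IsLeviCivita L.gb conn) {Y : VField (n + 1) M} {x : M}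
    {Z₁ Z₂ : VField (n + 2) N} (h₁ : L.IsLocalExtension Y x Z₁) (h₂ : L.IsLocalExtension Y x Z₂)
    (v : TangentSpace (𝓡 (n + 1)) x) :
    conn Z₁ (L.f x) (diff L.f x v) = conn Z₂ (L.f x) (diff L.f x v) := by
  have h := h₁.sub h₂
  have hadd := conn.isCovariantDerivativeOnUniv.add h₂.1 h.1
  rw [add_sub_cancel] at hadd
  rw [hadd, add_apply, conn_eq_zero hconn h.1 (h.2.mono fun y hy => by
    rw [hy]; simp), add_zero]

/-- The extension picked by `epsilon` may be replaced by any other one, because the difference of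
two extensions vanishes along the hypersurface. -/
theorem ambientDeriv_eq (hconn : IsLeviCivita L.gb conn) {Y : VField (n + 1) M} {x : M}
    {Z : VField (n + 2) N} (h : L.IsLocalExtension Y x Z) (v : TangentSpace (𝓡 (n + 1)) x) :
    L.ambientDeriv conn Y x v = conn Z (L.f x) (diff L.f x v) :=
  conn_eq_conn hconn (Classical.epsilon_spec (p := fun Z => L.IsLocalExtension Y x Z) ⟨Z, h⟩) h v

/-- Two fields with the same germ have the same extensions, so `epsilon` picks the same one; no
regularity is needed. -/
theorem nabla_congr {Y Y' : VField (n + 1) M} {x : M} (h : ∀ᶠ y in 𝓝 x, Y y = Y' y)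
    (v : TangentSpace (𝓡 (n + 1)) x) : L.nabla conn Y x v = L.nabla conn Y' x v := by
  have : (fun Z => L.IsLocalExtension Y x Z) = fun Z => L.IsLocalExtension Y' x Z := by
    funext Z
    refine propext (and_congr_right fun _ => ⟨fun hZ => ?_, fun hZ => ?_⟩)
    · filter_upwards [h, hZ] with y h₁ h₂
      rw [h₂, h₁]
    · filter_upwards [h, hZ] with y h₁ h₂
      rw [h₂, h₁]
  simp only [nabla, ambientDeriv, this]

variable (hconn : IsLeviCivita L.gb conn) (hgeod : L.IsTotallyGeodesic conn)

section
include hconn hgeod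

/-- Total geodesy means that `Q` discards nothing. The rules of `∇` below are checked after applying
the injective differential, where they become rules of the ambient connection. -/
theorem diff_nabla {U : Set M} (hU : IsOpen U) {Y : VField (n + 1) M} (hY : SmoothFieldOn Y U)
    {x : M} (hx : x ∈ U) {Z : VField (n + 2) N} (hZ : L.IsLocalExtension Y x Z)
    (v : TangentSpace (𝓡 (n + 1)) x) :
    diff L.f x (L.nabla conn Y x v) = conn Z (L.f x) (diff L.f x v) := by
  rw [← ambientDeriv_eq hconn hZ]
  exact (sub_eq_zero.1 (hgeod U Y hU hY x hx v)).symm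

theorem nabla_add {U : Set M} (hU : IsOpen U) {Y₁ Y₂ : VField (n + 1) M}
    (hY₁ : SmoothFieldOn Y₁ U) (hY₂ : SmoothFieldOn Y₂ U) {x : M} (hx : x ∈ U)
    (v : TangentSpace (𝓡 (n + 1)) x) :
    L.nabla conn (fun y => Y₁ y + Y₂ y) x v = L.nabla conn Y₁ x v + L.nabla conn Y₂ x v := by
  obtain ⟨Z₁, h₁⟩ := L.exists_isLocalExtension hU hY₁ hx
  obtain ⟨Z₂, h₂⟩ := L.exists_isLocalExtension hU hY₂ hx
  apply diff_injective L.immersion x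
  rw [map_add, diff_nabla hconn hgeod hU hY₁ hx h₁, diff_nabla hconn hgeod hU hY₂ hx h₂,
    diff_nabla hconn hgeod hU (hY₁.add hY₂) hx (h₁.add h₂),
    conn.isCovariantDerivativeOnUniv.add h₁.1 h₂.1]
  rfl

theorem nabla_smul {U : Set M} (hU : IsOpen U) {φ : M → ℝ} {Y : VField (n + 1) M}
    (hφ : ContMDiffOn (𝓡 (n + 1)) 𝓘(ℝ, ℝ) ∞ φ U) (hY : SmoothFieldOn Y U) {x : M} (hx : x ∈ U)
    (v : TangentSpace (𝓡 (n + 1)) x) :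
    L.nabla conn (fun y => φ y • Y y) x v
      = φ x • L.nabla conn Y x v + mvfderiv (𝓡 (n + 1)) φ x v • Y x := by
  obtain ⟨Z, hZ⟩ := L.exists_isLocalExtension hU hY hx
  obtain ⟨Φ, hΦ, h⟩ := L.exists_function_extension
    ((hφ.contMDiffAt (hU.mem_nhds hx)).mdifferentiableAt (by simp))
  apply diff_injective L.immersion x
  rw [map_add, map_smul, map_smul, diff_nabla hconn hgeod hU hY hx hZ,
    diff_nabla hconn hgeod hU (hY.smul hφ) hx (hZ.smul hΦ h),
    conn.isCovariantDerivativeOnUniv.leibniz hZ.1 hΦ, ← L.mvfderiv_diff hΦ h,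
    ← hZ.2.self_of_nhds, ← h.self_of_nhds]
  rfl

theorem nabla_add_dir {U : Set M} (hU : IsOpen U) {Y : VField (n + 1) M}
    (hY : SmoothFieldOn Y U) {x : M} (hx : x ∈ U) (v w : TangentSpace (𝓡 (n + 1)) x) :
    L.nabla conn Y x (v + w) = L.nabla conn Y x v + L.nabla conn Y x w := by
  obtain ⟨Z, hZ⟩ := L.exists_isLocalExtension hU hY hx
  apply diff_injective L.immersion x
  simp only [map_add, diff_nabla hconn hgeod hU hY hx hZ]

theorem nabla_smul_dir {U : Set M} (hU : IsOpen U) {Y : VField (n + 1) M}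
    (hY : SmoothFieldOn Y U) {x : M} (hx : x ∈ U) (c : ℝ) (v : TangentSpace (𝓡 (n + 1)) x) :
    L.nabla conn Y x (c • v) = c • L.nabla conn Y x v := by
  obtain ⟨Z, hZ⟩ := L.exists_isLocalExtension hU hY hx
  apply diff_injective L.immersion x
  simp only [map_smul, diff_nabla hconn hgeod hU hY hx hZ]

theorem mvfderiv_g {U : Set M} (hU : IsOpen U) {Y₁ Y₂ : VField (n + 1) M}
    (hY₁ : SmoothFieldOn Y₁ U) (hY₂ : SmoothFieldOn Y₂ U) {x : M} (hx : x ∈ U)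
    (v : TangentSpace (𝓡 (n + 1)) x) :
    mvfderiv (𝓡 (n + 1)) (fun y => L.g y (Y₁ y) (Y₂ y)) x v
      = L.g x (L.nabla conn Y₁ x v) (Y₂ x) + L.g x (Y₁ x) (L.nabla conn Y₂ x v) := by
  obtain ⟨Z₁, h₁⟩ := L.exists_isLocalExtension hU hY₁ hx
  obtain ⟨Z₂, h₂⟩ := L.exists_isLocalExtension hU hY₂ hx
  have h := hconn.metric Z₁ Z₂ (L.f x) h₁.1 h₂.1 (diff L.f x v)
  rw [L.mvfderiv_diff (φ := fun y => L.g y (Y₁ y) (Y₂ y)) (L.gb.mdifferentiableAt h₁.1 h₂.1)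
    (by filter_upwards [h₁.2, h₂.2] with y hy₁ hy₂; rw [hy₁, hy₂]; rfl),
    h₁.2.self_of_nhds, h₂.2.self_of_nhds, ← diff_nabla hconn hgeod hU hY₁ hx h₁,
    ← diff_nabla hconn hgeod hU hY₂ hx h₂] at h
  exact h

end

end LightlikeHypersurface
end Hypersurface
-- Pointwise geometry: the radical, the transversal field and `g̃`
section Hypersurface

variable {n : ℕ} {N : Type*} [TopologicalSpace N]
  [ChartedSpace (Model (n + 2)) N] [IsManifold (𝓡 (n + 2)) ∞ N]
  {M : Type*} [TopologicalSpace M]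
  [ChartedSpace (Model (n + 1)) M] [IsManifold (𝓡 (n + 1)) ∞ M]

instance finiteDimensional_tangentSpace {d : ℕ} {M : Type*} [TopologicalSpace M]
    [ChartedSpace (Model d) M] (x : M) : FiniteDimensional ℝ (TangentSpace (𝓡 d) x) :=
  inferInstanceAs (FiniteDimensional ℝ (Model d))

theorem finrank_tangentSpace {d : ℕ} {M : Type*} [TopologicalSpace M]
    [ChartedSpace (Model d) M] (x : M) : Module.finrank ℝ (TangentSpace (𝓡 d) x) = d :=
  (finrank_euclideanSpace_fin : Module.finrank ℝ (Model d) = d)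

namespace LightlikeHypersurface

variable {L : LightlikeHypersurface n N M} {conn : Connection (n + 2) N}

/-- The induced metric at a point as a bilinear map. -/
noncomputable def gLin (L : LightlikeHypersurface n N M) (x : M) :
    TangentSpace (𝓡 (n + 1)) x →ₗ[ℝ] TangentSpace (𝓡 (n + 1)) x →ₗ[ℝ] ℝ :=
  LinearMap.mk₂ ℝ (L.g x) (g_add_left x) (g_smul_left x) (g_add_right x) fun c v w =>
    g_smul_right x c v w

theorem finrank_screen (L : LightlikeHypersurface n N M) (x : M) :
    Module.finrank ℝ (L.screen x) = n := by
  obtain ⟨U, -, hx, e, -, he⟩ := L.screen_smooth x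
  rw [← (he x hx).2, finrank_span_eq_card (he x hx).1, Fintype.card_fin]

theorem g_xi_left (x : M) (v : TangentSpace (𝓡 (n + 1)) x) : L.g x (L.ξ x) v = 0 :=
  L.ξ_mem_radical x v

theorem g_xi_right (x : M) (v : TangentSpace (𝓡 (n + 1)) x) : L.g x v (L.ξ x) = 0 := by
  rw [g_comm, g_xi_left]

/-- The radical distribution is spanned by `ξ`. -/
theorem exists_smul_xi_of_mem_radical {x : M} {v : TangentSpace (𝓡 (n + 1)) x}
    (hv : v ∈ radical L.gb L.f x) : ∃ c : ℝ, c • L.ξ x = v := by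
  have h1 : Module.finrank ℝ (radical L.gb L.f x) = 1 := by
    have h := Submodule.finrank_add_eq_of_isCompl (L.screen_isCompl x)
    rw [finrank_screen, finrank_tangentSpace] at h
    omega
  have h0 : (⟨L.ξ x, L.ξ_mem_radical x⟩ : radical L.gb L.f x) ≠ 0 := fun h =>
    L.ξ_ne_zero x (congrArg Subtype.val h)
  obtain ⟨c, hc⟩ := (finrank_eq_one_iff_of_nonzero' _ h0).1 h1 ⟨v, hv⟩
  exact ⟨c, congrArg Subtype.val hc⟩

/-- The induced metric is positive semidefinite. -/
theorem g_self_nonneg (x : M) (v : TangentSpace (𝓡 (n + 1)) x) : 0 ≤ L.g x v v := by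
  obtain ⟨b, hb⟩ := L.gb.signature (L.f x)
  refine lorentz_nonneg_of_orthogonal_null
    -- All tangent vectors of the hypersurface are orthogonal to the null vector `ξ`.
    (B := (ContinuousLinearMap.coeLM ℝ).comp (L.gb.val (L.f x)).toLinearMap)
    (b := b) hb (u := diff L.f x (L.ξ x)) (w := diff L.f x v) ?_ (g_xi_left x (L.ξ x))
    (g_xi_left x v)
  exact (map_ne_zero_iff (diff L.f x) (diff_injective L.immersion x)).2 (L.ξ_ne_zero x)

theorem mem_radical_of_g_self_eq_zero {x : M} {v : TangentSpace (𝓡 (n + 1)) x}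
    (hv : L.g x v v = 0) : v ∈ radical L.gb L.f x :=
  fun w => eq_zero_of_isotropic_of_nonneg (B := L.gLin x) (g_comm x) (g_self_nonneg x) hv w

theorem g_self_pos {x : M} {v : TangentSpace (𝓡 (n + 1)) x} (hv : v ∈ L.screen x)
    (h0 : v ≠ 0) : 0 < L.g x v v := by
  refine lt_of_le_of_ne (g_self_nonneg x v) fun h => h0 ?_
  exact Submodule.disjoint_def.1 (L.screen_isCompl x).disjoint v hv
    (mem_radical_of_g_self_eq_zero h.symm)

/-- The defining properties of the lightlike transversal vector field. -/
theorem trans_spec (L : LightlikeHypersurface n N M) (x : M) :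
    L.gb.val (L.f x) (L.trans x) (diff L.f x (L.ξ x)) = 1 ∧
      L.gb.val (L.f x) (L.trans x) (L.trans x) = 0 ∧
      ∀ w ∈ L.screen x, L.gb.val (L.f x) (L.trans x) (diff L.f x w) = 0 := by
  refine Classical.epsilon_spec (p := fun V => L.gb.val (L.f x) V (diff L.f x (L.ξ x)) = 1 ∧
    L.gb.val (L.f x) V V = 0 ∧ ∀ w ∈ L.screen x, L.gb.val (L.f x) V (diff L.f x w) = 0) ?_
  have hnot : diff L.f x (L.ξ x) ∉ (L.screen x).map (diff L.f x).toLinearMap := by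
    rintro ⟨w, hw, hwξ⟩
    have hw' : w = L.ξ x := diff_injective L.immersion x hwξ
    exact L.ξ_ne_zero x (Submodule.disjoint_def.1 (L.screen_isCompl x).disjoint _
      (hw' ▸ hw) (L.ξ_mem_radical x))
  -- Normalizing and representing a functional that kills the screen but not `ξ` gives a vector
  -- satisfying the two linear conditions.
  obtain ⟨φ, hφ, hφs⟩ := Submodule.exists_le_ker_of_notMem hnot
  obtain ⟨b, hb⟩ := L.gb.signature (L.f x)
  obtain ⟨V, hV⟩ := lorentz_exists_represent
    (B := (ContinuousLinearMap.coeLM ℝ).comp (L.gb.val (L.f x)).toLinearMap) (b := b) hb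
    ((φ (diff L.f x (L.ξ x)))⁻¹ • φ)
  replace hV : ∀ w, L.gb.val (L.f x) V w = (φ (diff L.f x (L.ξ x)))⁻¹ * φ w := hV
  have h1 : L.gb.val (L.f x) V (diff L.f x (L.ξ x)) = 1 := by
    rw [hV, inv_mul_cancel₀ hφ]
  have h2 : ∀ w ∈ L.screen x, L.gb.val (L.f x) V (diff L.f x w) = 0 := by
    intro w hw
    have : φ (diff L.f x w) = 0 := hφs ⟨w, hw, rfl⟩
    rw [hV, this, mul_zero]
  have h3 : ∀ w, L.gb.val (L.f x) (diff L.f x (L.ξ x)) (diff L.f x w) = 0 := g_xi_left x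
  have h4 : L.gb.val (L.f x) (diff L.f x (L.ξ x)) V = 1 := by rw [L.gb.symm, h1]
  -- Subtracting this multiple of `ξ` makes the vector null, and keeps its pairings with `ξ` and the
  -- screen since `ξ` is in the radical.
  refine ⟨V - (L.gb.val (L.f x) V V / 2) • diff L.f x (L.ξ x), ?_, ?_, fun w hw => ?_⟩
  · simp [h1, h3]
  · simp [h1, h3, h4]
    ring
  · simp [h2 w hw, h3]

theorem eta_add (x : M) (v w : TangentSpace (𝓡 (n + 1)) x) :
    L.η x (v + w) = L.η x v + L.η x w := by simp [η]

theorem eta_smul (x : M) (c : ℝ) (v : TangentSpace (𝓡 (n + 1)) x) :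
    L.η x (c • v) = c * L.η x v := by simp [η]

theorem eta_xi (x : M) : L.η x (L.ξ x) = 1 := (trans_spec L x).1

theorem eta_of_mem_screen {x : M} {w : TangentSpace (𝓡 (n + 1)) x} (hw : w ∈ L.screen x) :
    L.η x w = 0 := (trans_spec L x).2.2 w hw

theorem P_of_mem_screen {x : M} {w : TangentSpace (𝓡 (n + 1)) x} (hw : w ∈ L.screen x) :
    L.P x w = w :=
  Submodule.projection_apply_left (L.screen_isCompl x) ⟨w, hw⟩

theorem P_xi (x : M) : L.P x (L.ξ x) = 0 :=
  Submodule.projection_apply_right (L.screen_isCompl x) ⟨_, L.ξ_mem_radical x⟩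

theorem P_mem_screen (x : M) (v : TangentSpace (𝓡 (n + 1)) x) : L.P x v ∈ L.screen x :=
  Submodule.projection_apply_mem (L.screen_isCompl x) v

/-- The decomposition of a tangent vector into its screen and radical parts. -/
theorem P_add_eta_smul_xi (x : M) (v : TangentSpace (𝓡 (n + 1)) x) :
    L.P x v + L.η x v • L.ξ x = v := by
  obtain ⟨w, hw, u, hu, rfl⟩ := Submodule.mem_sup.1
    ((L.screen_isCompl x).sup_eq_top ▸ Submodule.mem_top (x := v))
  obtain ⟨c, rfl⟩ := exists_smul_xi_of_mem_radical hu
  rw [map_add, map_smul, P_xi, P_of_mem_screen hw, eta_add, eta_smul, eta_xi,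
    eta_of_mem_screen hw]
  simp

theorem mem_screen_of_eta_eq_zero {x : M} {v : TangentSpace (𝓡 (n + 1)) x} (hv : L.η x v = 0) :
    v ∈ L.screen x := by
  rw [← P_add_eta_smul_xi (L := L) x v, hv, zero_smul, add_zero]
  exact P_mem_screen x v

/-- The nondegenerate metric `g̃` at a point as a bilinear map. -/
noncomputable def flatLin (L : LightlikeHypersurface n N M) (x : M) :
    TangentSpace (𝓡 (n + 1)) x →ₗ[ℝ] TangentSpace (𝓡 (n + 1)) x →ₗ[ℝ] ℝ :=
  LinearMap.mk₂ ℝ (L.flat x)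
    (fun u v w => by simp only [flat, g_add_left, eta_add]; ring)
    (fun c v w => by simp only [flat, g_smul_left, eta_smul, smul_eq_mul]; ring)
    (fun u v w => by simp only [flat, g_add_right, eta_add]; ring)
    (fun c v w => by simp only [flat, g_smul_right, eta_smul, smul_eq_mul]; ring)

theorem flatLin_apply (x : M) (v w : TangentSpace (𝓡 (n + 1)) x) :
    L.flatLin x v w = L.flat x v w := rfl

theorem flat_sub_left (x : M) (u v w : TangentSpace (𝓡 (n + 1)) x) :
    L.flat x (u - v) w = L.flat x u w - L.flat x v w := by
  simp only [← flatLin_apply, map_sub, LinearMap.sub_apply]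

theorem flat_add_left (x : M) (u v w : TangentSpace (𝓡 (n + 1)) x) :
    L.flat x (u + v) w = L.flat x u w + L.flat x v w := by
  simp only [← flatLin_apply, map_add, LinearMap.add_apply]

theorem flat_smul_left (x : M) (c : ℝ) (v w : TangentSpace (𝓡 (n + 1)) x) :
    L.flat x (c • v) w = c * L.flat x v w := by
  simp only [← flatLin_apply, map_smul, LinearMap.smul_apply, smul_eq_mul]

theorem flat_sum_left {ι : Type*} (s : Finset ι) (x : M) (v : ι → TangentSpace (𝓡 (n + 1)) x)
    (w : TangentSpace (𝓡 (n + 1)) x) :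
    L.flat x (∑ i ∈ s, v i) w = ∑ i ∈ s, L.flat x (v i) w := by
  simp only [← flatLin_apply, map_sum, LinearMap.sum_apply]

theorem flat_add_right (x : M) (u v w : TangentSpace (𝓡 (n + 1)) x) :
    L.flat x u (v + w) = L.flat x u v + L.flat x u w := by
  simp only [← flatLin_apply, map_add]

theorem flat_smul_right (x : M) (c : ℝ) (v w : TangentSpace (𝓡 (n + 1)) x) :
    L.flat x v (c • w) = c * L.flat x v w := by
  simp only [← flatLin_apply, map_smul, smul_eq_mul]

theorem flat_sum_right {ι : Type*} (s : Finset ι) (x : M) (v : TangentSpace (𝓡 (n + 1)) x)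
    (w : ι → TangentSpace (𝓡 (n + 1)) x) :
    L.flat x v (∑ i ∈ s, w i) = ∑ i ∈ s, L.flat x v (w i) := by
  simp only [← flatLin_apply, map_sum]

theorem flat_comm (x : M) (v w : TangentSpace (𝓡 (n + 1)) x) : L.flat x v w = L.flat x w v := by
  simp only [flat, g_comm x v w, mul_comm]

theorem flat_xi_right (x : M) (v : TangentSpace (𝓡 (n + 1)) x) :
    L.flat x v (L.ξ x) = L.η x v := by
  rw [flat, g_xi_right, eta_xi, zero_add, mul_one]

/-- Both summands of `g̃(v, v)` are nonnegative. If they vanish, `η(v) = 0` puts `v` in the screen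
and `g(v, v) = 0` puts it in the radical. -/
theorem flat_self_eq_zero {x : M} {v : TangentSpace (𝓡 (n + 1)) x} (hv : L.flat x v v = 0) :
    v = 0 := by
  have h1 := g_self_nonneg (L := L) x v
  have h2 := mul_self_nonneg (L.η x v)
  rw [flat] at hv
  have hη : L.η x v = 0 := mul_self_eq_zero.1 (by linarith)
  exact Submodule.disjoint_def.1 (L.screen_isCompl x).disjoint v (mem_screen_of_eta_eq_zero hη)
    (mem_radical_of_g_self_eq_zero (by linarith))

theorem flat_self_pos {x : M} {v : TangentSpace (𝓡 (n + 1)) x} (hv : v ≠ 0) :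
    0 < L.flat x v v :=
  lt_of_le_of_ne (add_nonneg (g_self_nonneg x v) (mul_self_nonneg _))
    fun h => hv (flat_self_eq_zero h.symm)

theorem eq_of_flat_eq {x : M} {v w : TangentSpace (𝓡 (n + 1)) x}
    (h : ∀ u, L.flat x v u = L.flat x w u) : v = w := by
  refine sub_eq_zero.1 (flat_self_eq_zero (L := L) ?_)
  rw [flat_sub_left, h, sub_self]

end LightlikeHypersurface
end Hypersurface
-- Diagonalization and Lagrange products
/-- A symmetric endomorphism of a finite-dimensional space with a positive definite bilinear form
is diagonalizable. -/
theorem iSup_eigenspace_eq_top_of_symmetric {V : Type*} [AddCommGroup V] [Module ℝ V]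
    [FiniteDimensional ℝ V] {B : V →ₗ[ℝ] V →ₗ[ℝ] ℝ} (hsymm : ∀ v w, B v w = B w v)
    (hpos : ∀ v, v ≠ 0 → 0 < B v v) {T : V →ₗ[ℝ] V} (hT : ∀ v w, B (T v) w = B v (T w)) :
    ⨆ μ : ℝ, Module.End.eigenspace T μ = ⊤ := by
  let core : InnerProductSpace.Core ℝ V :=
    { inner := fun v w => B v w
      conj_inner_symm := fun v w => by simpa using hsymm w v
      re_inner_nonneg := fun v => by
        by_cases hv : v = 0
        · simp [hv]
        · simpa using (hpos v hv).le
      add_left := fun u v w => by simp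
      smul_left := fun u v r => by simp
      definite := fun v hv => by
        by_contra h
        exact (hpos v h).ne' hv }
  let : NormedAddCommGroup V := core.toNormedAddCommGroup
  let : InnerProductSpace ℝ V := InnerProductSpace.ofCore core.toCore
  have hsT : T.IsSymmetric := fun v w => hT v w
  have := hsT.orthogonalComplement_iSup_eigenspaces_eq_bot
  rwa [Submodule.orthogonal_eq_bot_iff] at this

section Spectral

variable {n k : ℕ} {M : Type*} [TopologicalSpace M] [ChartedSpace (Model (n + 1)) M]
  {S : ∀ x : M, TangentSpace (𝓡 (n + 1)) x →L[ℝ] TangentSpace (𝓡 (n + 1)) x}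
  {ev : Fin (k + 1) → M → ℝ}

theorem mem_eigenDistribution {α : M → ℝ} {x : M} {v : TangentSpace (𝓡 (n + 1)) x} :
    v ∈ eigenDistribution S α x ↔ S x v = α x • v :=
  Module.End.mem_eigenspace_iff

/-- The product over the list `l` of the factors `(S - ev b) / (ev a - ev b)`; for the list of all
indices other than `a` this is the projection onto the eigenspace of `ev a`. -/
noncomputable def lagrangeProduct
    (S : ∀ x : M, TangentSpace (𝓡 (n + 1)) x →L[ℝ] TangentSpace (𝓡 (n + 1)) x)
    (ev : Fin (k + 1) → M → ℝ) (a : Fin (k + 1)) (x : M) :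
    List (Fin (k + 1)) → TangentSpace (𝓡 (n + 1)) x → TangentSpace (𝓡 (n + 1)) x
  | [], v => v
  | b :: l, v => (ev a x - ev b x)⁻¹ •
      (S x (lagrangeProduct S ev a x l v) - ev b x • lagrangeProduct S ev a x l v)

theorem lagrangeProduct_add (a : Fin (k + 1)) (x : M) (l : List (Fin (k + 1)))
    (v w : TangentSpace (𝓡 (n + 1)) x) :
    lagrangeProduct S ev a x l (v + w)
      = lagrangeProduct S ev a x l v + lagrangeProduct S ev a x l w := by
  induction l with
  | nil => rfl
  | cons b l ih =>
    simp only [lagrangeProduct, ih, map_add, smul_add, smul_sub]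
    abel

theorem lagrangeProduct_zero (a : Fin (k + 1)) (x : M) (l : List (Fin (k + 1))) :
    lagrangeProduct S ev a x l 0 = 0 := by
  induction l with
  | nil => rfl
  | cons b l ih => simp [lagrangeProduct, ih]

theorem lagrangeProduct_sum (a : Fin (k + 1)) (x : M) (l : List (Fin (k + 1)))
    {ι : Type*} (s : Finset ι) (v : ι → TangentSpace (𝓡 (n + 1)) x) :
    lagrangeProduct S ev a x l (∑ i ∈ s, v i) = ∑ i ∈ s, lagrangeProduct S ev a x l (v i) :=
  map_sum (⟨⟨lagrangeProduct S ev a x l, lagrangeProduct_zero a x l⟩,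
    lagrangeProduct_add a x l⟩ : _ →+ _) v s

/-- Each factor acts on an eigenvector by a scalar. Over all indices other than `a`, the product of
these scalars is `1` if `c = a`, and contains a zero factor otherwise. -/
theorem lagrangeProduct_of_mem {a c : Fin (k + 1)} {x : M} {v : TangentSpace (𝓡 (n + 1)) x}
    (hv : v ∈ eigenDistribution S (ev c) x) (l : List (Fin (k + 1))) :
    lagrangeProduct S ev a x l v
      = (l.map fun b => (ev a x - ev b x)⁻¹ * (ev c x - ev b x)).prod • v := by
  induction l with
  | nil => simp [lagrangeProduct]
  | cons b l ih =>
    rw [mem_eigenDistribution] at hv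
    simp only [lagrangeProduct, ih, map_smul, hv, List.map_cons, List.prod_cons]
    module

end Spectral

/-! ### Smooth spectral projections of an `A^∇`-tensor -/

section Hypersurface

variable {n k : ℕ} {N : Type*} [TopologicalSpace N]
  [ChartedSpace (Model (n + 2)) N] [IsManifold (𝓡 (n + 2)) ∞ N]
  {M : Type*} [TopologicalSpace M]
  [ChartedSpace (Model (n + 1)) M] [IsManifold (𝓡 (n + 1)) ∞ M]
  {L : LightlikeHypersurface n N M} {conn : Connection (n + 2) N}
  {S : ∀ x : M, TangentSpace (𝓡 (n + 1)) x →L[ℝ] TangentSpace (𝓡 (n + 1)) x}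
  {ev : Fin (k + 1) → M → ℝ}

/-- Only `S` and the eigenfunctions enter the product, and since `a ∉ l` no denominator vanishes. No
smooth eigenframe is needed. -/
theorem smoothFieldOn_lagrangeProduct (hS : SmoothEndField S) (hev : IsEigenfunctions S ev)
    (a : Fin (k + 1)) {l : List (Fin (k + 1))} (hl : a ∉ l) {X : VField (n + 1) M} {U : Set M}
    (hX : SmoothFieldOn X U) :
    SmoothFieldOn (fun x => lagrangeProduct S ev a x l (X x)) U := by
  induction l with
  | nil => exact hX
  | cons b l ih =>
    rw [List.mem_cons, not_or] at hl
    have ih' := ih hl.2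
    refine SmoothFieldOn.smul ?_ ((SmoothFieldOn.endField hS ih').sub
      (ih'.smul (hev.smooth b).contMDiffOn))
    refine ContMDiffOn.inv₀ ((hev.smooth a).sub (hev.smooth b)).contMDiffOn fun x _ h => ?_
    exact hl.1 (hev.distinct x a b (sub_eq_zero.1 h))

/-- The projection onto the eigenspace of `ev a` along the other eigenspaces. -/
noncomputable def spectralProjection
    (S : ∀ x : M, TangentSpace (𝓡 (n + 1)) x →L[ℝ] TangentSpace (𝓡 (n + 1)) x)
    (ev : Fin (k + 1) → M → ℝ) (a : Fin (k + 1)) (x : M) (v : TangentSpace (𝓡 (n + 1)) x) :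
    TangentSpace (𝓡 (n + 1)) x :=
  lagrangeProduct S ev a x (Finset.univ.erase a).toList v

theorem smoothFieldOn_spectralProjection (hS : SmoothEndField S) (hev : IsEigenfunctions S ev)
    (a : Fin (k + 1)) {X : VField (n + 1) M} {U : Set M} (hX : SmoothFieldOn X U) :
    SmoothFieldOn (fun x => spectralProjection S ev a x (X x)) U :=
  smoothFieldOn_lagrangeProduct hS hev a (by simp) hX

theorem spectralProjection_of_mem (hev : IsEigenfunctions S ev) {a : Fin (k + 1)} {x : M}
    {v : TangentSpace (𝓡 (n + 1)) x} (hv : v ∈ eigenDistribution S (ev a) x) :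
    spectralProjection S ev a x v = v := by
  rw [spectralProjection, lagrangeProduct_of_mem hv, Finset.prod_map_toList,
    Finset.prod_eq_one, one_smul]
  intro b hb
  refine inv_mul_cancel₀ fun h => ?_
  exact (Finset.ne_of_mem_erase hb) (hev.distinct x a b (sub_eq_zero.1 h)).symm

theorem spectralProjection_of_mem_ne {a c : Fin (k + 1)} (hac : c ≠ a) {x : M}
    {v : TangentSpace (𝓡 (n + 1)) x} (hv : v ∈ eigenDistribution S (ev c) x) :
    spectralProjection S ev a x v = 0 := by
  rw [spectralProjection, lagrangeProduct_of_mem hv, Finset.prod_map_toList,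
    Finset.prod_eq_zero (i := c) (by simp [hac]) (by simp), zero_smul]

namespace LightlikeHypersurface

/-- The screen is invariant under an endomorphism field that commutes with the projection `P`. -/
theorem IsATensor.apply_mem_screen (hS : L.IsATensor conn S) {x : M}
    {v : TangentSpace (𝓡 (n + 1)) x} (hv : v ∈ L.screen x) : S x v ∈ L.screen x := by
  rw [← P_of_mem_screen hv, ← hS.screen_preserving]
  exact P_mem_screen x _

theorem IsATensor.exists_apply_xi (hS : L.IsATensor conn S) (x : M) :
    ∃ c : ℝ, S x (L.ξ x) = c • L.ξ x := by
  have h : L.P x (S x (L.ξ x)) = 0 := by rw [hS.screen_preserving, P_xi, map_zero]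
  have h2 := P_add_eta_smul_xi (L := L) x (S x (L.ξ x))
  rw [h, zero_add] at h2
  exact ⟨_, h2.symm⟩

theorem IsATensor.exists_eigenfunction_xi (hS : L.IsATensor conn S)
    (hev : IsEigenfunctions S ev) (x : M) : ∃ a, L.ξ x ∈ eigenDistribution S (ev a) x := by
  obtain ⟨c, hc⟩ := hS.exists_apply_xi x
  obtain ⟨a, rfl⟩ := (hev.hasEigenvalue_iff x c).1
    (Module.End.hasEigenvalue_of_hasEigenvector (x := L.ξ x)
      ⟨Module.End.mem_eigenspace_iff.2 hc, L.ξ_ne_zero x⟩)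
  exact ⟨a, mem_eigenDistribution.2 hc⟩

theorem IsATensor.eta_apply (hS : L.IsATensor conn S) {x : M} {c : ℝ}
    (hc : S x (L.ξ x) = c • L.ξ x) (v : TangentSpace (𝓡 (n + 1)) x) :
    L.η x (S x v) = c * L.η x v := by
  conv_lhs => rw [← P_add_eta_smul_xi (L := L) x v]
  rw [map_add, map_smul, hc, eta_add, eta_smul, eta_smul, eta_xi,
    eta_of_mem_screen (hS.apply_mem_screen (P_mem_screen x v))]
  ring

/-- Besides `g`-symmetry this uses `η ∘ S = c η`, which holds because `S` preserves the screen and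
multiplies `ξ` by `c`. -/
theorem IsATensor.flat_symm (hS : L.IsATensor conn S) (x : M)
    (v w : TangentSpace (𝓡 (n + 1)) x) : L.flat x (S x v) w = L.flat x v (S x w) := by
  obtain ⟨c, hc⟩ := hS.exists_apply_xi x
  rw [flat, flat, hS.symm, hS.eta_apply hc, hS.eta_apply hc]
  ring

theorem IsATensor.g_eq_zero (hS : L.IsATensor conn S) (hev : IsEigenfunctions S ev)
    {a b : Fin (k + 1)} (hab : a ≠ b) {x : M} {v w : TangentSpace (𝓡 (n + 1)) x}
    (hv : v ∈ eigenDistribution S (ev a) x) (hw : w ∈ eigenDistribution S (ev b) x) :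
    L.g x v w = 0 := by
  have h := hS.symm x v w
  rw [mem_eigenDistribution.1 hv, mem_eigenDistribution.1 hw, g_smul_left, g_smul_right] at h
  by_contra hne
  exact hab (hev.distinct x a b (mul_right_cancel₀ hne h))

theorem IsATensor.flat_eq_zero (hS : L.IsATensor conn S) (hev : IsEigenfunctions S ev)
    {a b : Fin (k + 1)} (hab : a ≠ b) {x : M} {v w : TangentSpace (𝓡 (n + 1)) x}
    (hv : v ∈ eigenDistribution S (ev a) x) (hw : w ∈ eigenDistribution S (ev b) x) :
    L.flat x v w = 0 := by
  have h := hS.flat_symm x v w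
  rw [mem_eigenDistribution.1 hv, mem_eigenDistribution.1 hw, flat_smul_left,
    flat_smul_right] at h
  by_contra hne
  exact hab (hev.distinct x a b (mul_right_cancel₀ hne h))

/-- Each tangent vector is a sum of eigenvectors. -/
theorem IsATensor.exists_sum_eigenvectors (hS : L.IsATensor conn S)
    (hev : IsEigenfunctions S ev) (x : M) (v : TangentSpace (𝓡 (n + 1)) x) :
    ∃ c : Fin (k + 1) → TangentSpace (𝓡 (n + 1)) x,
      (∀ a, c a ∈ eigenDistribution S (ev a) x) ∧ ∑ a, c a = v := by
  have h := iSup_eigenspace_eq_top_of_symmetric (B := L.flatLin x) (flat_comm x)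
    (fun v hv => flat_self_pos hv) (T := (S x).toLinearMap) (hS.flat_symm x)
  have h2 : (⊤ : Submodule ℝ (TangentSpace (𝓡 (n + 1)) x))
      ≤ ⨆ a, eigenDistribution S (ev a) x := by
    rw [← h]
    refine iSup_le fun μ => ?_
    -- The listed values are all the eigenvalues, so any other `μ` has zero eigenspace.
    by_cases hμ : Module.End.HasEigenvalue (S x).toLinearMap μ
    · obtain ⟨a, rfl⟩ := (hev.hasEigenvalue_iff x μ).1 hμ
      exact le_iSup (fun a => eigenDistribution S (ev a) x) a
    · rw [Module.End.hasEigenvalue_iff, not_not] at hμ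
      rw [hμ]
      exact bot_le
  have h3 := h2 (Submodule.mem_top (x := v))
  obtain ⟨c, hc⟩ := (Submodule.mem_iSup_iff_exists_finsupp _ v).1 h3
  refine ⟨c, hc.1, ?_⟩
  rw [← hc.2, Finsupp.sum_fintype _ _ fun _ => rfl]

theorem IsATensor.sum_spectralProjection (hS : L.IsATensor conn S) (hev : IsEigenfunctions S ev)
    (x : M) (v : TangentSpace (𝓡 (n + 1)) x) :
    (∀ a, spectralProjection S ev a x v ∈ eigenDistribution S (ev a) x) ∧
      ∑ a, spectralProjection S ev a x v = v := by
  obtain ⟨c, hc, rfl⟩ := hS.exists_sum_eigenvectors hev x v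
  have h : ∀ a, spectralProjection S ev a x (∑ b, c b) = c a := by
    intro a
    rw [spectralProjection, lagrangeProduct_sum, Finset.sum_eq_single a]
    · exact spectralProjection_of_mem hev (hc a)
    · intro b _ hb
      exact spectralProjection_of_mem_ne hb (hc b)
    · simp
  exact ⟨fun a => (h a).symm ▸ hc a, Finset.sum_congr rfl fun a _ => h a⟩

theorem IsATensor.flat_spectralProjection (hS : L.IsATensor conn S) (hev : IsEigenfunctions S ev)
    {a : Fin (k + 1)} {x : M} (v : TangentSpace (𝓡 (n + 1)) x) {w : TangentSpace (𝓡 (n + 1)) x}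
    (hw : w ∈ eigenDistribution S (ev a) x) :
    L.flat x (spectralProjection S ev a x v) w = L.flat x v w := by
  obtain ⟨h1, h2⟩ := hS.sum_spectralProjection hev x v
  conv_rhs => rw [← h2]
  rw [flat_sum_left, Finset.sum_eq_single a]
  · intro b _ hb
    exact hS.flat_eq_zero hev hb (h1 b) hw
  · simp

/-- The `g̃`-orthogonal projection onto an eigenspace is the spectral projection. -/
theorem IsATensor.proj_eq (hS : L.IsATensor conn S) (hev : IsEigenfunctions S ev)
    (a : Fin (k + 1)) (x : M) (v : TangentSpace (𝓡 (n + 1)) x) :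
    L.proj x (eigenDistribution S (ev a) x) v = spectralProjection S ev a x v := by
  set D := eigenDistribution S (ev a) x with hD
  have h0 : spectralProjection S ev a x v ∈ D ∧
      ∀ w ∈ D, L.flat x (v - spectralProjection S ev a x v) w = 0 := by
    refine ⟨(hS.sum_spectralProjection hev x v).1 a, fun w hw => ?_⟩
    rw [flat_sub_left, hS.flat_spectralProjection hev v hw, sub_self]
  have h1 := Classical.epsilon_spec
    (p := fun q => q ∈ D ∧ ∀ w ∈ D, L.flat x (v - q) w = 0) ⟨_, h0⟩
  change L.proj x D v ∈ D ∧ ∀ w ∈ D, L.flat x (v - L.proj x D v) w = 0 at h1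
  -- The difference of two orthogonal projections lies in `D` and is orthogonal to `D`, so positive
  -- definiteness makes it zero.
  refine sub_eq_zero.1 (flat_self_eq_zero (L := L) ?_)
  have hm : L.proj x D v - spectralProjection S ev a x v ∈ D := D.sub_mem h1.1 h0.1
  have h2 := h1.2 _ hm
  have h3 := h0.2 _ hm
  rw [flat_sub_left] at h2 h3 ⊢
  linarith

end LightlikeHypersurface
end Hypersurface
-- Smoothness of the gradient
section Matrices

variable {d : ℕ} {M : Type*} [TopologicalSpace M] [ChartedSpace (Model d) M]

theorem contMDiffOn_det {m : ℕ} {A : M → Matrix (Fin m) (Fin m) ℝ} {U : Set M}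
    (hA : ∀ i j, ContMDiffOn (𝓡 d) 𝓘(ℝ, ℝ) ∞ (fun x => A x i j) U) :
    ContMDiffOn (𝓡 d) 𝓘(ℝ, ℝ) ∞ (fun x => (A x).det) U := by
  simp only [Matrix.det_apply']
  refine contMDiffOn_finsetSum fun σ _ => ?_
  exact contMDiffOn_const.mul (contMDiffOn_finsetProd fun i _ => hA _ _)

/-- By Cramer's rule the entries of the inverse are quotients of determinants. -/
theorem contMDiffOn_inv_apply {m : ℕ} {A : M → Matrix (Fin m) (Fin m) ℝ} {U : Set M}
    (hA : ∀ i j, ContMDiffOn (𝓡 d) 𝓘(ℝ, ℝ) ∞ (fun x => A x i j) U)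
    (hdet : ∀ x ∈ U, (A x).det ≠ 0) (i j : Fin m) :
    ContMDiffOn (𝓡 d) 𝓘(ℝ, ℝ) ∞ (fun x => (A x)⁻¹ i j) U := by
  simp only [Matrix.inv_def, Ring.inverse_eq_inv', Matrix.smul_apply, smul_eq_mul,
    Matrix.adjugate_apply]
  refine ((contMDiffOn_det hA).inv₀ hdet).mul (contMDiffOn_det fun a b => ?_)
  simp only [Matrix.updateRow_apply]
  split_ifs
  · exact contMDiffOn_const
  · exact hA a b

theorem contMDiffOn_mvfderiv_apply [IsManifold (𝓡 d) ∞ M] {φ : M → ℝ}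
    (hφ : ContMDiff (𝓡 d) 𝓘(ℝ, ℝ) ∞ φ)
    {X : VField d M} {U : Set M} (hX : SmoothFieldOn X U) :
    ContMDiffOn (𝓡 d) 𝓘(ℝ, ℝ) ∞ (fun x => mvfderiv (𝓡 d) φ x (X x)) U := by
  have h1 := (ContMDiff.contMDiff_tangentMap hφ (m := ∞) (by simp)).comp_contMDiffOn hX
  exact (contMDiff_snd_tangentBundle_modelSpace ℝ 𝓘(ℝ, ℝ)).comp_contMDiffOn h1

end Matrices

section Hypersurface

variable {n : ℕ} {N : Type*} [TopologicalSpace N]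
  [ChartedSpace (Model (n + 2)) N] [IsManifold (𝓡 (n + 2)) ∞ N]
  {M : Type*} [TopologicalSpace M]
  [ChartedSpace (Model (n + 1)) M] [IsManifold (𝓡 (n + 1)) ∞ M]
  {L : LightlikeHypersurface n N M}

namespace LightlikeHypersurface

/-- The Gram matrix of a frame of the screen. -/
noncomputable def gram (L : LightlikeHypersurface n N M) (e : Fin n → VField (n + 1) M) (x : M) :
    Matrix (Fin n) (Fin n) ℝ :=
  Matrix.of fun i j => L.g x (e i x) (e j x)

theorem gram_mulVec (e : Fin n → VField (n + 1) M) (x : M) (a : Fin n → ℝ) (l : Fin n) :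
    (L.gram e x).mulVec a l = L.g x (e l x) (∑ i, a i • e i x) := by
  change _ = L.gLin x (e l x) (∑ i, a i • e i x)
  simp only [map_sum, map_smul, smul_eq_mul, Matrix.mulVec, dotProduct, gram, Matrix.of_apply]
  exact Finset.sum_congr rfl fun i _ => mul_comm _ _

theorem det_gram_ne_zero {e : Fin n → VField (n + 1) M} {x : M}
    (he : LinearIndependent ℝ fun i => e i x)
    (hspan : Submodule.span ℝ (Set.range fun i => e i x) = L.screen x) :
    (L.gram e x).det ≠ 0 := by
  intro h0
  obtain ⟨a, ha, ha0⟩ := Matrix.exists_mulVec_eq_zero_iff.2 h0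
  have hl : ∀ l, L.g x (e l x) (∑ i, a i • e i x) = 0 := fun l => by
    rw [← gram_mulVec, ha0, Pi.zero_apply]
  -- A kernel vector of the Gram matrix gives an isotropic vector of the screen, where `g` is
  -- definite.
  have hself : L.g x (∑ i, a i • e i x) (∑ i, a i • e i x) = 0 := by
    change L.gLin x (∑ i, a i • e i x) (∑ i, a i • e i x) = 0
    rw [map_sum]
    refine Finset.sum_eq_zero fun l _ => ?_
    rw [map_smul]
    exact mul_eq_zero_of_right _ ((g_comm x _ _).trans (hl l))
  have hmem : ∑ i, a i • e i x ∈ L.screen x := by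
    rw [← hspan]
    exact Submodule.sum_mem _ fun i _ => Submodule.smul_mem _ _ (Submodule.subset_span ⟨i, rfl⟩)
  have hz : ∑ i, a i • e i x = 0 := by
    by_contra hne
    exact (g_self_pos hmem hne).ne' hself
  exact ha (funext (Fintype.linearIndependent_iff.1 he a hz))

/-- The gradient in a frame of the screen. -/
theorem exists_grad_eq_of_frame {e : Fin n → VField (n + 1) M} {x : M}
    (he : LinearIndependent ℝ fun i => e i x)
    (hspan : Submodule.span ℝ (Set.range fun i => e i x) = L.screen x)
    (φ : TangentSpace (𝓡 (n + 1)) x →ₗ[ℝ] ℝ) (w : TangentSpace (𝓡 (n + 1)) x) :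
    L.flat x (∑ i, ((L.gram e x)⁻¹.mulVec fun j => φ (e j x)) i • e i x + φ (L.ξ x) • L.ξ x) w
      = φ w := by
  set a := (L.gram e x)⁻¹.mulVec fun j => φ (e j x) with ha
  have hmem : ∀ i, e i x ∈ L.screen x := fun i => hspan ▸ Submodule.subset_span ⟨i, rfl⟩
  have hηa : L.η x (∑ i, a i • e i x) = 0 :=
    eta_of_mem_screen (Submodule.sum_mem _ fun i _ => Submodule.smul_mem _ _ (hmem i))
  -- The coefficients `a` solve the Gram system; the `ξ` component can be treated separately because
  -- `g̃(ξ, ·) = η` vanishes on the screen.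
  have hGa : (L.gram e x).mulVec a = fun j => φ (e j x) := by
    rw [ha, Matrix.mulVec_mulVec, Matrix.mul_nonsing_inv _
      (isUnit_iff_ne_zero.2 (det_gram_ne_zero he hspan)), Matrix.one_mulVec]
  have hl : ∀ l, L.flat x (∑ i, a i • e i x + φ (L.ξ x) • L.ξ x) (e l x) = φ (e l x) := by
    intro l
    have := congrFun hGa l
    rw [gram_mulVec] at this
    rw [flat_add_left, flat_smul_left, flat_comm x (L.ξ x), flat_xi_right,
      eta_of_mem_screen (hmem l), flat, eta_of_mem_screen (hmem l), g_comm, this]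
    ring
  have hξ : L.flat x (∑ i, a i • e i x + φ (L.ξ x) • L.ξ x) (L.ξ x) = φ (L.ξ x) := by
    rw [flat_xi_right, eta_add, hηa, eta_smul, eta_xi]
    ring
  have hP := P_mem_screen (L := L) x w
  rw [← hspan] at hP
  have hs : L.flat x (∑ i, a i • e i x + φ (L.ξ x) • L.ξ x) (L.P x w) = φ (L.P x w) := by
    generalize L.P x w = u at hP
    induction hP using Submodule.span_induction with
    | mem v hv => obtain ⟨l, rfl⟩ := hv; exact hl l
    | zero => rw [← flatLin_apply, map_zero, map_zero]
    | add u v _ _ hu hv => rw [flat_add_right, hu, hv, map_add]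
    | smul c v _ hv => rw [flat_smul_right, hv, map_smul, smul_eq_mul]
  rw [← P_add_eta_smul_xi (L := L) x w, flat_add_right, flat_smul_right, hs, hξ, map_add,
    map_smul, smul_eq_mul]

/-- The defining property of the gradient. -/
theorem flat_grad (φ : M → ℝ) (x : M) (w : TangentSpace (𝓡 (n + 1)) x) :
    L.flat x (L.grad φ x) w = mvfderiv (𝓡 (n + 1)) φ x w := by
  obtain ⟨U, -, hx, e, -, he⟩ := L.screen_smooth x
  exact Classical.epsilon_spec
    (p := fun v => ∀ w, L.flat x v w = mvfderiv (𝓡 (n + 1)) φ x w)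
    ⟨_, exists_grad_eq_of_frame (he x hx).1 (he x hx).2
      (mvfderiv (𝓡 (n + 1)) φ x).toLinearMap⟩ w

/-- The gradient of a smooth function is smooth. -/
theorem smoothFieldOn_grad {φ : M → ℝ} (hφ : ContMDiff (𝓡 (n + 1)) 𝓘(ℝ, ℝ) ∞ φ) :
    SmoothFieldOn (L.grad φ) Set.univ := by
  intro x _
  obtain ⟨U, hU, hx, e, hes, he⟩ := L.screen_smooth x
  suffices h : SmoothFieldOn (L.grad φ) U from
    (ContMDiffOn.contMDiffAt h (hU.mem_nhds hx)).contMDiffWithinAt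
  have hξ : SmoothFieldOn L.ξ U := L.ξ_smooth.mono (Set.subset_univ U)
  have hs : SmoothFieldOn (fun y =>
      ∑ i, ((L.gram e y)⁻¹.mulVec fun j => mvfderiv (𝓡 (n + 1)) φ y (e j y)) i • e i y
        + mvfderiv (𝓡 (n + 1)) φ y (L.ξ y) • L.ξ y) U := by
    refine SmoothFieldOn.add (SmoothFieldOn.sum fun i _ => SmoothFieldOn.smul ?_ (hes i))
      (SmoothFieldOn.smul (contMDiffOn_mvfderiv_apply hφ hξ) hξ)
    simp only [Matrix.mulVec, dotProduct]
    refine contMDiffOn_finsetSum fun j _ => ?_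
    refine (contMDiffOn_inv_apply (fun a b => L.contMDiffOn_g (hes a) (hes b)) (fun y hy => ?_)
      i j).mul (contMDiffOn_mvfderiv_apply hφ (hes j))
    exact det_gram_ne_zero (he y hy).1 (he y hy).2
  refine hs.congr fun y hy => eq_of_flat_eq (L := L) fun w => ?_
  rw [flat_grad]
  exact (exists_grad_eq_of_frame (he y hy).1 (he y hy).2
    (mvfderiv (𝓡 (n + 1)) φ y).toLinearMap w).symm

end LightlikeHypersurface
end Hypersurface
-- Logarithms of differences of eigenfunctions
section LogDerivative

variable {d : ℕ} {M : Type*} [TopologicalSpace M] [ChartedSpace (Model d) M]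

theorem contMDiff_log_abs_sub {φ ψ : M → ℝ}
    (hφ : ContMDiff (𝓡 d) 𝓘(ℝ, ℝ) ∞ φ) (hψ : ContMDiff (𝓡 d) 𝓘(ℝ, ℝ) ∞ ψ)
    (hne : ∀ x, φ x ≠ ψ x) : ContMDiff (𝓡 d) 𝓘(ℝ, ℝ) ∞ (fun x => Real.log |φ x - ψ x|) := by
  intro x
  -- `Real.log` is even by convention, so the absolute value can be dropped.
  simp only [Real.log_abs]
  have h1 : ContMDiffAt 𝓘(ℝ, ℝ) 𝓘(ℝ, ℝ) ∞ Real.log (φ x - ψ x) :=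
    (Real.contDiffAt_log.2 (sub_ne_zero.2 (hne x))).contMDiffAt
  exact h1.comp x ((hφ.sub hψ) x)

theorem mvfderiv_log_abs_sub {φ ψ : M → ℝ} {x : M}
    (hφ : MDifferentiableAt (𝓡 d) 𝓘(ℝ, ℝ) φ x) (hψ : MDifferentiableAt (𝓡 d) 𝓘(ℝ, ℝ) ψ x)
    (hne : φ x ≠ ψ x) (v : TangentSpace (𝓡 d) x) :
    mvfderiv (𝓡 d) (fun y => Real.log |φ y - ψ y|) x v
      = (φ x - ψ x)⁻¹ * (mvfderiv (𝓡 d) φ x v - mvfderiv (𝓡 d) ψ x v) := by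
  simp only [Real.log_abs]
  have hne' : φ x - ψ x ≠ 0 := sub_ne_zero.2 hne
  have h1 : MDifferentiableAt 𝓘(ℝ, ℝ) 𝓘(ℝ, ℝ) Real.log (φ x - ψ x) :=
    (Real.differentiableAt_log hne').mdifferentiableAt
  have h2 := mvfderiv_comp_apply x (f := fun y => φ y - ψ y) h1 (hφ.sub hψ) v
  refine h2.trans ?_
  have h3 : mvfderiv 𝓘(ℝ, ℝ) Real.log (φ x - ψ x) = fderiv ℝ Real.log (φ x - ψ x) :=
    mfderiv_eq_fderiv
  rw [h3]
  have h4 : mfderiv (𝓡 d) 𝓘(ℝ, ℝ) (fun y => φ y - ψ y) x v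
      = mvfderiv (𝓡 d) φ x v - mvfderiv (𝓡 d) ψ x v :=
    congrArg (fun T => T v) (mvfderiv_fun_sub hφ hψ)
  rw [h4]
  have h5 : ∀ t : ℝ, fderiv ℝ Real.log (φ x - ψ x) t = (φ x - ψ x)⁻¹ * t := fun t => by
    rw [fderiv_eq_smul_deriv, Real.deriv_log, smul_eq_mul, mul_comm]
  exact h5 _

end LogDerivative

/-! ### The cyclic condition on sections of eigenspace distributions -/

section Hypersurface

variable {n k : ℕ} {N : Type*} [TopologicalSpace N]
  [ChartedSpace (Model (n + 2)) N] [IsManifold (𝓡 (n + 2)) ∞ N]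
  {M : Type*} [TopologicalSpace M]
  [ChartedSpace (Model (n + 1)) M] [IsManifold (𝓡 (n + 1)) ∞ M]
  {L : LightlikeHypersurface n N M} {conn : Connection (n + 2) N}
  {S : ∀ x : M, TangentSpace (𝓡 (n + 1)) x →L[ℝ] TangentSpace (𝓡 (n + 1)) x}
  {ev : Fin (k + 1) → M → ℝ} {U : Set M} {x : M}

namespace LightlikeHypersurface

theorem eta_nabla_of_mem_screen {ρ : M → ℝ} {V : Set M} (hρ : L.ScreenUmbilicOn conn ρ V)
    (hU : IsOpen U) (hUV : U ⊆ V) {Y : VField (n + 1) M} (hY : SmoothFieldOn Y U)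
    (hYs : ∀ y ∈ U, Y y ∈ L.screen y) (hx : x ∈ U) (v : TangentSpace (𝓡 (n + 1)) x) :
    L.η x (L.nabla conn Y x v) = ρ x * L.g x v (Y x) := by
  rw [← hρ U Y hU hUV hY x hx v, C]
  congr 1
  refine nabla_congr ?_ v
  filter_upwards [hU.mem_nhds hx] with y hy
  rw [P_of_mem_screen (hYs y hy)]

section TensorCalculus

variable (hconn : IsLeviCivita L.gb conn) (hgeod : L.IsTotallyGeodesic conn)
  (hS : L.IsATensor conn S)
include hconn hgeod hS

/-- For the polarization, additivity and constant multiples in each argument suffice; tensoriality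
is not required. -/
theorem nablaEnd_add_dir (hU : IsOpen U) {X₁ X₂ Y : VField (n + 1) M} (hY : SmoothFieldOn Y U)
    (hx : x ∈ U) :
    L.nablaEnd conn S (fun y => X₁ y + X₂ y) Y x
      = L.nablaEnd conn S X₁ Y x + L.nablaEnd conn S X₂ Y x := by
  simp only [nablaEnd]
  rw [nabla_add_dir hconn hgeod hU hY hx,
    nabla_add_dir hconn hgeod hU (SmoothFieldOn.endField hS.smooth hY) hx, map_add]
  abel

theorem nablaEnd_smul_dir (hU : IsOpen U) (c : ℝ) {X Y : VField (n + 1) M}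
    (hY : SmoothFieldOn Y U) (hx : x ∈ U) :
    L.nablaEnd conn S (fun y => c • X y) Y x = c • L.nablaEnd conn S X Y x := by
  simp only [nablaEnd]
  rw [nabla_smul_dir hconn hgeod hU hY hx,
    nabla_smul_dir hconn hgeod hU (SmoothFieldOn.endField hS.smooth hY) hx, map_smul, smul_sub]

theorem nablaEnd_add (hU : IsOpen U) {X Y₁ Y₂ : VField (n + 1) M} (hY₁ : SmoothFieldOn Y₁ U)
    (hY₂ : SmoothFieldOn Y₂ U) (hx : x ∈ U) :
    L.nablaEnd conn S X (fun y => Y₁ y + Y₂ y) x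
      = L.nablaEnd conn S X Y₁ x + L.nablaEnd conn S X Y₂ x := by
  simp only [nablaEnd, map_add]
  rw [nabla_add hconn hgeod hU hY₁ hY₂ hx,
    nabla_add hconn hgeod hU (SmoothFieldOn.endField hS.smooth hY₁)
      (SmoothFieldOn.endField hS.smooth hY₂) hx, map_add]
  abel

theorem nablaEnd_smul (hU : IsOpen U) (c : ℝ) {X Y : VField (n + 1) M}
    (hY : SmoothFieldOn Y U) (hx : x ∈ U) :
    L.nablaEnd conn S X (fun y => c • Y y) x = c • L.nablaEnd conn S X Y x := by
  simp only [nablaEnd, map_smul]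
  rw [nabla_smul hconn hgeod hU (φ := fun _ => c) contMDiffOn_const hY hx,
    nabla_smul hconn hgeod hU (φ := fun _ => c) contMDiffOn_const
      (SmoothFieldOn.endField hS.smooth hY) hx, mvfderiv_const]
  simp [smul_sub]

/-- The expansion of the cubic form of the tensor at a sum of two vector fields. -/
theorem cyclic_add (hU : IsOpen U) {X Z : VField (n + 1) M} (hX : SmoothFieldOn X U)
    (hZ : SmoothFieldOn Z U) (hx : x ∈ U) :
    (L.flat x (L.nablaEnd conn S X X x) (Z x) + L.flat x (L.nablaEnd conn S X Z x) (X x)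
        + L.flat x (L.nablaEnd conn S Z X x) (X x))
      + (L.flat x (L.nablaEnd conn S Z Z x) (X x) + L.flat x (L.nablaEnd conn S Z X x) (Z x)
        + L.flat x (L.nablaEnd conn S X Z x) (Z x)) = 0 := by
  have h := hS.cyclic U _ hU (hX.add hZ) x hx
  have hXX := hS.cyclic U _ hU hX x hx
  have hZZ := hS.cyclic U _ hU hZ x hx
  rw [nablaEnd_add hconn hgeod hS hU hX hZ hx, nablaEnd_add_dir hconn hgeod hS hU hX hx,
    nablaEnd_add_dir hconn hgeod hS hU hZ hx] at h
  simp only [flat_comm x (X x + Z x), flat_add_left, flat_add_right] at h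
  rw [flat_comm] at hXX hZZ
  linarith

/-- The polarized identity of an `A^∇`-tensor. -/
theorem cyclic_polarized (hU : IsOpen U) {X Z : VField (n + 1) M} (hX : SmoothFieldOn X U)
    (hZ : SmoothFieldOn Z U) (hx : x ∈ U) :
    L.flat x (L.nablaEnd conn S X X x) (Z x) + L.flat x (L.nablaEnd conn S X Z x) (X x)
        + L.flat x (L.nablaEnd conn S Z X x) (X x) = 0 := by
  have h1 := cyclic_add hconn hgeod hS hU hX hZ hx
  -- Replacing `Z` by `-Z` changes the sign of the part linear in `Z` and fixes the quadratic part,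
  -- so each part vanishes separately.
  have h2 := cyclic_add hconn hgeod hS hU hX
    (SmoothFieldOn.smul (φ := fun _ => (-1 : ℝ)) contMDiffOn_const hZ) hx
  simp only [nablaEnd_smul hconn hgeod hS hU (-1 : ℝ) hZ hx,
    nablaEnd_smul_dir hconn hgeod hS hU (-1 : ℝ) hX hx,
    nablaEnd_smul_dir hconn hgeod hS hU (-1 : ℝ) hZ hx,
    flat_smul_left, flat_smul_right] at h2
  linarith

/-- The derivative of the tensor on a section of an eigenspace distribution. -/
theorem flat_nablaEnd (hev : IsEigenfunctions S ev) (hU : IsOpen U) {a b : Fin (k + 1)}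
    {X Y : VField (n + 1) M} (hY : SmoothFieldOn Y U)
    (hYa : ∀ y ∈ U, Y y ∈ eigenDistribution S (ev a) y) (hx : x ∈ U)
    {z : TangentSpace (𝓡 (n + 1)) x} (hz : z ∈ eigenDistribution S (ev b) x) :
    L.flat x (L.nablaEnd conn S X Y x) z
      = (ev a x - ev b x) * L.flat x (L.nabla conn Y x (X x)) z
        + mvfderiv (𝓡 (n + 1)) (ev a) x (X x) * L.flat x (Y x) z := by
  have h1 : L.nabla conn (fun y => S y (Y y)) x (X x)
      = L.nabla conn (fun y => ev a y • Y y) x (X x) := by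
    refine nabla_congr ?_ _
    filter_upwards [hU.mem_nhds hx] with y hy
    exact mem_eigenDistribution.1 (hYa y hy)
  -- The Leibniz rule gives the derivative of `ev a`; symmetry moves `S` onto `z`, which yields the
  -- factor `ev b`.
  rw [nablaEnd, h1, nabla_smul hconn hgeod hU (hev.smooth a).contMDiffOn hY hx, flat_sub_left,
    hS.flat_symm, mem_eigenDistribution.1 hz, flat_add_left, flat_smul_left, flat_smul_left,
    flat_smul_right]
  ring

/-- An eigenfunction is constant in the directions of its eigenspace distribution. -/
theorem mvfderiv_eigenfunction_self (hev : IsEigenfunctions S ev) (hU : IsOpen U)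
    {a : Fin (k + 1)} {X : VField (n + 1) M} (hX : SmoothFieldOn X U)
    (hXa : ∀ y ∈ U, X y ∈ eigenDistribution S (ev a) y) (hx : x ∈ U) :
    mvfderiv (𝓡 (n + 1)) (ev a) x (X x) = 0 := by
  have h := hS.cyclic U X hU hX x hx
  rw [flat_comm, flat_nablaEnd hconn hgeod hS hev hU hX hXa hx (hXa x hx), sub_self, zero_mul,
    zero_add] at h
  rcases mul_eq_zero.1 h with h | h
  · exact h
  · rw [flat_self_eq_zero h, map_zero]

/-- The basic identity for sections of two different eigenspace distributions. -/
theorem eigen_sections_identity (hev : IsEigenfunctions S ev) (hU : IsOpen U) {a b : Fin (k + 1)}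
    (hab : a ≠ b) {X Z : VField (n + 1) M} (hX : SmoothFieldOn X U) (hZ : SmoothFieldOn Z U)
    (hXa : ∀ y ∈ U, X y ∈ eigenDistribution S (ev a) y)
    (hZb : ∀ y ∈ U, Z y ∈ eigenDistribution S (ev b) y) (hx : x ∈ U) :
    (ev a x - ev b x) * (2 * L.g x (L.nabla conn X x (X x)) (Z x)
        + L.η x (L.nabla conn X x (X x)) * L.η x (Z x)
        - L.η x (L.nabla conn Z x (X x)) * L.η x (X x))
      + mvfderiv (𝓡 (n + 1)) (ev a) x (Z x) * L.flat x (X x) (X x) = 0 := by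
  have h := cyclic_polarized hconn hgeod hS hU hX hZ hx
  rw [flat_nablaEnd hconn hgeod hS hev hU hX hXa hx (hZb x hx),
    flat_nablaEnd hconn hgeod hS hev hU hX hXa hx (hXa x hx),
    flat_nablaEnd hconn hgeod hS hev hU hZ hZb hx (hXa x hx),
    hS.flat_eq_zero hev hab (hXa x hx) (hZb x hx),
    hS.flat_eq_zero hev hab.symm (hZb x hx) (hXa x hx)] at h
  -- Differentiating `g(X, Z) = 0` along `X` replaces `g(X, ∇_X Z)` by `-g(∇_X X, Z)`. Compatibility
  -- is available for `g` only, not for `g̃`, so the `η` terms remain.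
  have hg := mvfderiv_g hconn hgeod hU hX hZ hx (X x)
  have h0 : mfderiv (𝓡 (n + 1)) 𝓘(ℝ, ℝ) (fun y => L.g y (X y) (Z y)) x
      = mfderiv (𝓡 (n + 1)) 𝓘(ℝ, ℝ) (fun _ : M => (0 : ℝ)) x := by
    refine Filter.EventuallyEq.mfderiv_eq ?_
    filter_upwards [hU.mem_nhds hx] with y hy
    exact hS.g_eq_zero hev hab (hXa y hy) (hZb y hy)
  have h1 : mvfderiv (𝓡 (n + 1)) (fun y => L.g y (X y) (Z y)) x (X x) = 0 := by
    have h2 : mvfderiv (𝓡 (n + 1)) (fun y => L.g y (X y) (Z y)) x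
        = mvfderiv (𝓡 (n + 1)) (fun _ : M => (0 : ℝ)) x := h0
    rw [h2, mvfderiv_const]
    rfl
  rw [h1, g_comm x (X x)] at hg
  simp only [flat] at h ⊢
  linear_combination h - (ev a x - ev b x) * hg

end TensorCalculus

/-- Every vector in the intersection of an eigenspace and the screen extends to a smooth section of
that intersection. -/
theorem IsATensor.exists_section (hS : L.IsATensor conn S) (hev : IsEigenfunctions S ev)
    (hU : IsOpen U) (hx : x ∈ U) {a : Fin (k + 1)} {z : TangentSpace (𝓡 (n + 1)) x}
    (hz : z ∈ eigenDistribution S (ev a) x) (hzs : z ∈ L.screen x) :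
    ∃ V : Set M, IsOpen V ∧ V ⊆ U ∧ x ∈ V ∧ ∃ Z : VField (n + 1) M, SmoothFieldOn Z V ∧
      (∀ y ∈ V, Z y ∈ eigenDistribution S (ev a) y ∧ Z y ∈ L.screen y) ∧ Z x = z := by
  obtain ⟨W, hW, hxW, e, hes, he⟩ := L.screen_smooth x
  rw [← (he x hxW).2, Submodule.mem_span_range_iff_exists_fun] at hzs
  obtain ⟨c, rfl⟩ := hzs
  -- Lagrange products are polynomials in `S`, so they preserve the screen, and projecting a screen
  -- section leaves it in the screen.
  have hinv : ∀ y (l : List (Fin (k + 1))) (v : TangentSpace (𝓡 (n + 1)) y), v ∈ L.screen y →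
      lagrangeProduct S ev a y l v ∈ L.screen y := by
    intro y l v hv
    induction l with
    | nil => exact hv
    | cons b l ih =>
      exact Submodule.smul_mem _ _ (Submodule.sub_mem _ (hS.apply_mem_screen ih)
        (Submodule.smul_mem _ _ ih))
  refine ⟨W ∩ U, hW.inter hU, Set.inter_subset_right, ⟨hxW, hx⟩,
    fun y => spectralProjection S ev a y (∑ i, c i • e i y), ?_, fun y hy => ⟨?_, ?_⟩, ?_⟩
  · refine smoothFieldOn_spectralProjection hS.smooth hev a (SmoothFieldOn.sum fun i _ => ?_)
    exact SmoothFieldOn.smul (φ := fun _ => c i) contMDiffOn_const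
      ((hes i).mono Set.inter_subset_left)
  · exact (hS.sum_spectralProjection hev y _).1 a
  · refine hinv y _ _ ?_
    rw [← (he y hy.1).2]
    exact Submodule.sum_mem _ fun i _ => Submodule.smul_mem _ _ (Submodule.subset_span ⟨i, rfl⟩)
  · exact spectralProjection_of_mem hev hz

/-- The index of the eigenfunction of `ξ` is locally constant. -/
theorem IsATensor.eventually_xi_mem (hS : L.IsATensor conn S) (hev : IsEigenfunctions S ev)
    {a : Fin (k + 1)} (ha : L.ξ x ∈ eigenDistribution S (ev a) x) :
    ∀ᶠ y in 𝓝 x, L.ξ y ∈ eigenDistribution S (ev a) y := by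
  -- Not being an eigenvector for `ev b` is an open condition. Near `x` this excludes all the
  -- finitely many `b ≠ a`, while `ξ` is always an eigenvector for some index.
  have h : ∀ b, b ≠ a → ∀ᶠ y in 𝓝 x, L.ξ y ∉ eigenDistribution S (ev b) y := by
    intro b hb
    have hs : SmoothFieldOn (fun y => S y (L.ξ y) - ev b y • L.ξ y) Set.univ :=
      (SmoothFieldOn.endField hS.smooth L.ξ_smooth).sub
        (SmoothFieldOn.smul (hev.smooth b).contMDiffOn L.ξ_smooth)
    have h0 : S x (L.ξ x) - ev b x • L.ξ x ≠ 0 := by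
      rw [mem_eigenDistribution.1 ha, ← sub_smul]
      exact smul_ne_zero (fun h => hb (hev.distinct x a b (sub_eq_zero.1 h)).symm)
        (L.ξ_ne_zero x)
    filter_upwards [hs.eventually_ne_zero isOpen_univ (Set.mem_univ x) h0] with y hy hmem
    exact hy (sub_eq_zero.2 (mem_eigenDistribution.1 hmem))
  have h2 : ∀ᶠ y in 𝓝 x, ∀ b, b ≠ a → L.ξ y ∉ eigenDistribution S (ev b) y := by
    rw [Filter.eventually_all]
    intro b
    by_cases hb : b = a
    · simp [hb]
    · simpa [hb] using h b hb
  filter_upwards [h2] with y hy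
  obtain ⟨b, hb⟩ := hS.exists_eigenfunction_xi hev y
  by_cases hba : b = a
  · exact hba ▸ hb
  · exact absurd hb (hy b hba)

/-- Eigenvectors for eigenvalues other than that of `ξ` lie in the screen. -/
theorem IsATensor.mem_screen (hS : L.IsATensor conn S) (hev : IsEigenfunctions S ev)
    {a b : Fin (k + 1)} (hab : b ≠ a) (ha : L.ξ x ∈ eigenDistribution S (ev a) x)
    {z : TangentSpace (𝓡 (n + 1)) x} (hz : z ∈ eigenDistribution S (ev b) x) :
    z ∈ L.screen x := by
  refine mem_screen_of_eta_eq_zero ?_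
  rw [← flat_xi_right]
  exact hS.flat_eq_zero hev hab hz ha

end LightlikeHypersurface
end Hypersurface
-- Umbilicity factor and mean curvature fields
section Hypersurface

variable {n k : ℕ} {N : Type*} [TopologicalSpace N]
  [ChartedSpace (Model (n + 2)) N] [IsManifold (𝓡 (n + 2)) ∞ N]
  {M : Type*} [TopologicalSpace M]
  [ChartedSpace (Model (n + 1)) M] [IsManifold (𝓡 (n + 1)) ∞ M]
  {L : LightlikeHypersurface n N M} {conn : Connection (n + 2) N}
  {S : ∀ x : M, TangentSpace (𝓡 (n + 1)) x →L[ℝ] TangentSpace (𝓡 (n + 1)) x}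
  {ev : Fin (k + 1) → M → ℝ} {U : Set M} {x : M} {ρ : M → ℝ}

theorem smoothFieldOn_univ_of_local {X : VField (n + 1) M}
    (h : ∀ x, ∃ U : Set M, IsOpen U ∧ x ∈ U ∧ SmoothFieldOn X U) : SmoothFieldOn X Set.univ := by
  intro x _
  obtain ⟨U, hU, hx, hX⟩ := h x
  exact (ContMDiffOn.contMDiffAt hX (hU.mem_nhds hx)).contMDiffWithinAt

namespace LightlikeHypersurface

/-- A nonzero screen vector has `g(v, v) > 0`, so `C` determines the factor; this needs a screen of
positive rank. -/
theorem ScreenUmbilicOn.eq_of_mem {ρ' : M → ℝ} {V : Set M} (hU : IsOpen U) (hV : IsOpen V)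
    (h : L.ScreenUmbilicOn conn ρ U) (h' : L.ScreenUmbilicOn conn ρ' V) (hn : 0 < n)
    (hxU : x ∈ U) (hxV : x ∈ V) : ρ x = ρ' x := by
  obtain ⟨W, hW, hxW, e, hes, he⟩ := L.screen_smooth x
  have hmem : e ⟨0, hn⟩ x ∈ L.screen x := (he x hxW).2 ▸ Submodule.subset_span ⟨_, rfl⟩
  have hpos := g_self_pos hmem ((he x hxW).1.ne_zero ⟨0, hn⟩)
  have hO : IsOpen (W ∩ (U ∩ V)) := hW.inter (hU.inter hV)
  have hs : SmoothFieldOn (e ⟨0, hn⟩) (W ∩ (U ∩ V)) := (hes _).mono Set.inter_subset_left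
  have h1 := h _ _ hO (fun y hy => hy.2.1) hs x ⟨hxW, hxU, hxV⟩ (e ⟨0, hn⟩ x)
  have h2 := h' _ _ hO (fun y hy => hy.2.2) hs x ⟨hxW, hxU, hxV⟩ (e ⟨0, hn⟩ x)
  exact mul_right_cancel₀ hpos.ne' (h1.symm.trans h2)

/-- The local umbilicity factors of the screen distribution can be glued. -/
theorem exists_global_umbilicity_factor (h : L.ScreenTotallyUmbilical conn) :
    ∃ ρ : M → ℝ, ContMDiff (𝓡 (n + 1)) 𝓘(ℝ, ℝ) ∞ ρ ∧ L.ScreenUmbilicOn conn ρ Set.univ := by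
  choose U hU hxU ρ hρ hC using h
  rcases Nat.eq_zero_or_pos n with hn | hn
  -- For `n = 0` the metric `g` vanishes and any factor works. The local factors need not agree, so
  -- zero is chosen instead of gluing them.
  · refine ⟨fun _ => 0, contMDiff_const, fun V Y hV _ hY x hx v => ?_⟩
    have hbot : L.screen x = ⊥ := by
      rw [← Submodule.finrank_eq_zero (R := ℝ), finrank_screen, hn]
    have hg : L.g x v (Y x) = 0 := by
      rw [← P_add_eta_smul_xi (L := L) x v, g_add_left, g_smul_left, g_xi_left]
      have hP := P_mem_screen (L := L) x v
      rw [hbot, Submodule.mem_bot] at hP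
      simp [hP, g, inducedMetric]
    rw [hC x (V ∩ U x) Y (hV.inter (hU x)) Set.inter_subset_right
      (hY.mono Set.inter_subset_left) x ⟨hx, hxU x⟩, hg, mul_zero, mul_zero]
  · have heq : ∀ x, ∀ y ∈ U x, ρ y y = ρ x y := fun x y hy =>
      (hC y).eq_of_mem (hU y) (hU x) (hC x) hn (hxU y) hy
    refine ⟨fun x => ρ x x, fun x => ?_, fun V Y hV _ hY x hx v => ?_⟩
    · refine ((hρ x).contMDiffAt ((hU x).mem_nhds (hxU x))).congr_of_eventuallyEq ?_
      filter_upwards [(hU x).mem_nhds (hxU x)] with y hy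
      exact heq x y hy
    · exact hC x (V ∩ U x) Y (hV.inter (hU x)) Set.inter_subset_right
        (hY.mono Set.inter_subset_left) x ⟨hx, hxU x⟩ v

/-- The screen component of the derivative of a section of an eigenspace distribution that does
not contain `ξ`. -/
theorem flat_nabla_self (hconn : IsLeviCivita L.gb conn) (hgeod : L.IsTotallyGeodesic conn)
    (hS : L.IsATensor conn S) (hev : IsEigenfunctions S ev) (hU : IsOpen U) {i m j : Fin (k + 1)} (him : i ≠ m) (hij : i ≠ j)
    (hm : ∀ y ∈ U, L.ξ y ∈ eigenDistribution S (ev m) y) {X : VField (n + 1) M}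
    (hX : SmoothFieldOn X U) (hXi : ∀ y ∈ U, X y ∈ eigenDistribution S (ev i) y) (hx : x ∈ U)
    {w : TangentSpace (𝓡 (n + 1)) x} (hw : w ∈ eigenDistribution S (ev j) x)
    (hws : w ∈ L.screen x) :
    L.flat x (L.nabla conn X x (X x)) w = L.g x (X x) (X x) *
      (-(1 / 2) * mvfderiv (𝓡 (n + 1)) (fun y => Real.log |ev i y - ev j y|) x w) := by
  obtain ⟨V, hV, hVU, hxV, Z, hZ, hZj, hZx⟩ := hS.exists_section hev hU hx hw hws
  have h := eigen_sections_identity hconn hgeod hS hev hV hij (hX.mono hVU) hZ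
    (fun y hy => hXi y (hVU hy)) (fun y hy => (hZj y hy).1) hxV
  -- As `ev j` is constant along `Z`, the derivative of `ev i` is that of `ev i - ev j`, which
  -- produces the logarithm.
  have h0 := mvfderiv_eigenfunction_self hconn hgeod hS hev hV hZ (fun y hy => (hZj y hy).1) hxV
  have hne : ev i x - ev j x ≠ 0 := fun h0 => hij (hev.distinct x i j (sub_eq_zero.1 h0))
  rw [mvfderiv_log_abs_sub (((hev.smooth i) x).mdifferentiableAt (by simp))
    (((hev.smooth j) x).mdifferentiableAt (by simp)) (sub_ne_zero.1 hne), ← hZx, h0]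
  rw [flat, eta_of_mem_screen (hS.mem_screen hev him (hm x hx) (hXi x hx)),
    eta_of_mem_screen (hZj x hxV).2] at h
  rw [flat, eta_of_mem_screen (hZj x hxV).2]
  linear_combination (1 / 2) * (ev i x - ev j x)⁻¹ * h
    - L.g x (L.nabla conn X x (X x)) (Z x) * mul_inv_cancel₀ hne

section Umbilicity

variable (hconn : IsLeviCivita L.gb conn) (hgeod : L.IsTotallyGeodesic conn)
  (hS : L.IsATensor conn S) (hev : IsEigenfunctions S ev)
  (hρ : L.ScreenUmbilicOn conn ρ Set.univ)
include hconn hgeod hS hev hρ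

/-- The eigenfunction of `ξ` is constant in the directions of the other eigenspaces. -/
theorem mvfderiv_eigenfunction_xi (hU : IsOpen U) {m j : Fin (k + 1)} (hmj : m ≠ j)
    (hm : ∀ y ∈ U, L.ξ y ∈ eigenDistribution S (ev m) y) {Z : VField (n + 1) M}
    (hZ : SmoothFieldOn Z U)
    (hZj : ∀ y ∈ U, Z y ∈ eigenDistribution S (ev j) y ∧ Z y ∈ L.screen y) (hx : x ∈ U) :
    mvfderiv (𝓡 (n + 1)) (ev m) x (Z x) = 0 := by
  have hξ : SmoothFieldOn L.ξ U := L.ξ_smooth.mono (Set.subset_univ U)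
  have h := eigen_sections_identity hconn hgeod hS hev hU hmj hξ hZ hm (fun y hy => (hZj y hy).1) hx
  -- Differentiating `g(ξ, Z) = 0` gives `g(∇_ξ ξ, Z) = 0`. Umbilicity gives `η(∇_ξ Z) = ρ g(ξ, Z) =
  -- 0`, so only the derivative of `ev m` survives.
  have h1 := mvfderiv_g hconn hgeod hU hξ hZ hx (L.ξ x)
  simp only [g_xi_left] at h1
  rw [mvfderiv_const, zero_apply, add_zero] at h1
  rw [← h1, eta_of_mem_screen (hZj x hx).2,
    eta_nabla_of_mem_screen hρ hU (Set.subset_univ U) hZ (fun y hy => (hZj y hy).2) hx, g_xi_left,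
    flat_xi_right, eta_xi] at h
  linarith

/-- Sections of the eigenspace distribution containing `ξ`. -/
theorem nabla_self_eq_of_xi_mem (hU : IsOpen U) {i : Fin (k + 1)}
    (hi : ∀ y ∈ U, L.ξ y ∈ eigenDistribution S (ev i) y) {X : VField (n + 1) M}
    (hX : SmoothFieldOn X U) (hXi : ∀ y ∈ U, X y ∈ eigenDistribution S (ev i) y) (hx : x ∈ U) :
    L.nabla conn X x (X x)
      = L.proj x (eigenDistribution S (ev i) x) (L.nabla conn X x (X x)) := by
  rw [hS.proj_eq hev]
  set u := L.nabla conn X x (X x) with hu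
  refine eq_of_flat_eq (L := L) fun w => ?_
  obtain ⟨c, hc, rfl⟩ := hS.exists_sum_eigenvectors hev x w
  rw [flat_sum_right, flat_sum_right]
  refine Finset.sum_congr rfl fun j _ => ?_
  by_cases hji : j = i
  · subst hji
    exact (hS.flat_spectralProjection hev u (hc j)).symm
  · rw [hS.flat_eq_zero hev (Ne.symm hji) ((hS.sum_spectralProjection hev x u).1 i) (hc j)]
    have hs := hS.mem_screen hev hji (hi x hx) (hc j)
    obtain ⟨V, hV, hVU, hxV, Z, hZ, hZj, hZx⟩ := hS.exists_section hev hU hx (hc j) hs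
    have h := eigen_sections_identity hconn hgeod hS hev hV (Ne.symm hji) (hX.mono hVU) hZ
      (fun y hy => hXi y (hVU hy)) (fun y hy => (hZj y hy).1) hxV
    -- Here `X` may have a `ξ` component. The term `η(∇_X Z) η(X)` still vanishes, because
    -- umbilicity makes its first factor `ρ g(X, Z) = 0`.
    rw [mvfderiv_eigenfunction_xi hconn hgeod hS hev hρ hV (Ne.symm hji)
      (fun y hy => hi y (hVU hy)) hZ hZj hxV,
      eta_nabla_of_mem_screen hρ hV (Set.subset_univ V) hZ (fun y hy => (hZj y hy).2) hxV,
      hS.g_eq_zero hev (Ne.symm hji) (hXi x hx) (hZj x hxV).1, eta_of_mem_screen (hZj x hxV).2,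
      hZx, ← hu] at h
    have hne : ev i x - ev j x ≠ 0 := fun h0 => hji (hev.distinct x i j (sub_eq_zero.1 h0)).symm
    rw [flat, eta_of_mem_screen hs]
    have h2 : (ev i x - ev j x) * L.g x u (c j) = 0 := by linarith
    rw [(mul_eq_zero.1 h2).resolve_left hne]
    ring

/-- A criterion for the mean curvature vector at a point. -/
theorem nabla_self_eq_of_flat (hU : IsOpen U) {i m : Fin (k + 1)} (him : i ≠ m)
    (hm : ∀ y ∈ U, L.ξ y ∈ eigenDistribution S (ev m) y) {X : VField (n + 1) M}
    (hX : SmoothFieldOn X U) (hXi : ∀ y ∈ U, X y ∈ eigenDistribution S (ev i) y) (hx : x ∈ U)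
    {h : TangentSpace (𝓡 (n + 1)) x} (hξ : L.η x h = ρ x)
    (hi : ∀ w ∈ eigenDistribution S (ev i) x, L.flat x h w = 0)
    (hj : ∀ j, j ≠ i → ∀ w ∈ eigenDistribution S (ev j) x, w ∈ L.screen x → L.flat x h w
      = -(1 / 2) * mvfderiv (𝓡 (n + 1)) (fun y => Real.log |ev i y - ev j y|) x w) :
    L.nabla conn X x (X x)
      = L.proj x (eigenDistribution S (ev i) x) (L.nabla conn X x (X x))
        + L.g x (X x) (X x) • h := by
  have hηu : L.η x (L.nabla conn X x (X x)) = ρ x * L.g x (X x) (X x) :=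
    eta_nabla_of_mem_screen hρ hU (Set.subset_univ U) hX
      (fun y hy => hS.mem_screen hev him (hm y hy) (hXi y hy)) hx (X x)
  have hscreen : ∀ j, j ≠ i → ∀ w ∈ eigenDistribution S (ev j) x, w ∈ L.screen x →
      L.flat x (L.nabla conn X x (X x)) w = L.g x (X x) (X x) * L.flat x h w := by
    intro j hji w hw hws
    rw [hj j hji w hw hws, flat_nabla_self hconn hgeod hS hev hU him (Ne.symm hji) hm hX hXi hx
      hw hws]
  rw [hS.proj_eq hev]
  set u := L.nabla conn X x (X x)
  refine eq_of_flat_eq (L := L) fun w => ?_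
  obtain ⟨c, hc, rfl⟩ := hS.exists_sum_eigenvectors hev x w
  rw [flat_sum_right, flat_sum_right]
  refine Finset.sum_congr rfl fun j _ => ?_
  rw [flat_add_left, flat_smul_left]
  by_cases hji : j = i
  · subst hji
    rw [hS.flat_spectralProjection hev u (hc j), hi _ (hc j)]
    ring
  · rw [hS.flat_eq_zero hev (Ne.symm hji) ((hS.sum_spectralProjection hev x u).1 i) (hc j),
      zero_add]
    by_cases hjm : j = m
    · subst hjm
      -- The eigenspace of `ξ` may exceed the radical. Its vectors split into a screen part, still
      -- in the eigenspace, where the logarithm formula applies, and a `ξ` part, where umbilicity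
      -- applies.
      have hP : L.P x (c j) = c j - L.η x (c j) • L.ξ x :=
        eq_sub_of_add_eq (P_add_eta_smul_xi x (c j))
      have hPj : L.P x (c j) ∈ eigenDistribution S (ev j) x :=
        hP ▸ Submodule.sub_mem _ (hc j) (Submodule.smul_mem _ _ (hm x hx))
      rw [← P_add_eta_smul_xi (L := L) x (c j), flat_add_right, flat_add_right, flat_smul_right,
        flat_smul_right, flat_xi_right, flat_xi_right, hξ, hηu,
        hscreen j hji _ hPj (P_mem_screen x _)]
      ring
    · exact hscreen j hji _ (hc j) (hS.mem_screen hev hjm (hm x hx) (hc j))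

end Umbilicity

/-- The mean curvature vector field of the eigenspace distribution of `ev i` at the points where
this distribution does not contain `ξ`. -/
noncomputable def eigenMeanCurvature (L : LightlikeHypersurface n N M)
    (S : ∀ x : M, TangentSpace (𝓡 (n + 1)) x →L[ℝ] TangentSpace (𝓡 (n + 1)) x)
    (ev : Fin (k + 1) → M → ℝ) (ρ : M → ℝ) (i : Fin (k + 1)) : VField (n + 1) M := fun x =>
  -(1 / 2 : ℝ) • (∑ j with j ≠ i, spectralProjection S ev j x
      (L.grad (fun y => Real.log |ev i y - ev j y|) x
        - mvfderiv (𝓡 (n + 1)) (fun y => Real.log |ev i y - ev j y|) x (L.ξ x) • L.ξ x))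
    + ρ x • L.ξ x

theorem smoothFieldOn_eigenMeanCurvature (hS : L.IsATensor conn S) (hev : IsEigenfunctions S ev)
    (hρ : ContMDiff (𝓡 (n + 1)) 𝓘(ℝ, ℝ) ∞ ρ) (i : Fin (k + 1)) :
    SmoothFieldOn (L.eigenMeanCurvature S ev ρ i) Set.univ := by
  refine SmoothFieldOn.add (SmoothFieldOn.smul (φ := fun _ => -(1 / 2 : ℝ)) contMDiffOn_const
    (SmoothFieldOn.sum fun j hj => ?_)) (SmoothFieldOn.smul hρ.contMDiffOn L.ξ_smooth)
  have hφ : ContMDiff (𝓡 (n + 1)) 𝓘(ℝ, ℝ) ∞ (fun y => Real.log |ev i y - ev j y|) :=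
    contMDiff_log_abs_sub (hev.smooth i) (hev.smooth j) fun x h =>
      (Finset.mem_filter.1 hj).2 (hev.distinct x i j h).symm
  exact smoothFieldOn_spectralProjection hS.smooth hev j ((smoothFieldOn_grad hφ).sub
    (SmoothFieldOn.smul (contMDiffOn_mvfderiv_apply hφ L.ξ_smooth) L.ξ_smooth))

/-- Orthogonality leaves only the summand with index `j`. Since the `ξ` component of each gradient
was subtracted, pairing with `ξ` gives exactly `ρ`. -/
theorem flat_eigenMeanCurvature (hS : L.IsATensor conn S) (hev : IsEigenfunctions S ev)
    {i j : Fin (k + 1)} {w : TangentSpace (𝓡 (n + 1)) x}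
    (hw : w ∈ eigenDistribution S (ev j) x) :
    L.flat x (L.eigenMeanCurvature S ev ρ i x) w =
      (if j ≠ i then -(1 / 2) * (mvfderiv (𝓡 (n + 1)) (fun y => Real.log |ev i y - ev j y|) x w
        - mvfderiv (𝓡 (n + 1)) (fun y => Real.log |ev i y - ev j y|) x (L.ξ x) * L.η x w)
        else 0) + ρ x * L.η x w := by
  rw [eigenMeanCurvature, flat_add_left, flat_smul_left, flat_smul_left, flat_sum_left,
    flat_comm x (L.ξ x), flat_xi_right]
  congr 1
  have h0 : ∀ l, l ≠ j → ∀ v, L.flat x (spectralProjection S ev l x v) w = 0 := fun l hl v =>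
    hS.flat_eq_zero hev hl ((hS.sum_spectralProjection hev x v).1 l) hw
  split_ifs with hji
  · rw [Finset.sum_eq_single j (fun l _ hl => h0 l hl _) (fun h => absurd (by simpa using hji) h),
      hS.flat_spectralProjection hev _ hw, flat_sub_left, flat_grad, flat_smul_left,
      flat_comm x (L.ξ x), flat_xi_right]
  · rw [Finset.sum_eq_zero, mul_zero]
    intro l hl
    refine h0 l (fun hlj => ?_) _
    exact (Finset.mem_filter.1 hl).2 (hlj.trans (not_not.1 hji))

theorem exists_open_xi_mem (hS : L.IsATensor conn S) (hev : IsEigenfunctions S ev) (hU : IsOpen U)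
    (hx : x ∈ U) : ∃ m, ∃ V : Set M, IsOpen V ∧ x ∈ V ∧ V ⊆ U ∧
      ∀ y ∈ V, L.ξ y ∈ eigenDistribution S (ev m) y := by
  obtain ⟨m, hm⟩ := hS.exists_eigenfunction_xi hev x
  obtain ⟨V, hV, hVo, hxV⟩ := eventually_nhds_iff.1 (hS.eventually_xi_mem hev hm)
  exact ⟨m, V ∩ U, hVo.inter hU, ⟨hxV, hx⟩, Set.inter_subset_right, fun y hy => hV y hy.1⟩

theorem xi_notMem_of_ne (hev : IsEigenfunctions S ev) {i m : Fin (k + 1)} (him : i ≠ m)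
    (hm : L.ξ x ∈ eigenDistribution S (ev m) x) : L.ξ x ∉ eigenDistribution S (ev i) x := by
  intro hi
  rw [mem_eigenDistribution] at hm hi
  exact him (hev.distinct x i m (smul_left_injective ℝ (L.ξ_ne_zero x) (hi.symm.trans hm)))

open Classical in
/-- The field `eigenMeanCurvature`, set to zero where the distribution contains `ξ`, is a mean
curvature vector field. -/
theorem isMeanCurvature_eigenDistribution (hconn : IsLeviCivita L.gb conn)
    (hgeod : L.IsTotallyGeodesic conn) (hS : L.IsATensor conn S) (hev : IsEigenfunctions S ev)
    (hρs : ContMDiff (𝓡 (n + 1)) 𝓘(ℝ, ℝ) ∞ ρ) (hρ : L.ScreenUmbilicOn conn ρ Set.univ)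
    (i : Fin (k + 1)) :
    L.IsMeanCurvature conn (eigenDistribution S (ev i)) (fun x =>
      if L.ξ x ∈ eigenDistribution S (ev i) x then 0 else L.eigenMeanCurvature S ev ρ i x) := by
  refine ⟨smoothFieldOn_univ_of_local fun x => ?_, fun U X hU hX hXi x hx => ?_⟩
  -- Near each point `ξ` stays in one eigenspace, so the case distinction is locally constant and
  -- preserves smoothness.
  · obtain ⟨m, V, hV, hxV, -, hm⟩ := exists_open_xi_mem hS hev isOpen_univ (Set.mem_univ x)
    refine ⟨V, hV, hxV, ?_⟩
    by_cases him : i = m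
    · refine (SmoothFieldOn.smul (φ := fun _ => (0 : ℝ)) contMDiffOn_const
        (L.ξ_smooth.mono (Set.subset_univ V))).congr fun y hy => ?_
      rw [if_pos (him ▸ hm y hy), zero_smul]
    · refine ((smoothFieldOn_eigenMeanCurvature hS hev hρs i).mono
        (Set.subset_univ V)).congr fun y hy => ?_
      rw [if_neg (xi_notMem_of_ne hev him (hm y hy))]
  · obtain ⟨m, V, hV, hxV, hVU, hm⟩ := exists_open_xi_mem hS hev hU hx
    beta_reduce
    by_cases him : i = m
    · subst him
      rw [if_pos (hm x hxV), smul_zero, add_zero]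
      exact nabla_self_eq_of_xi_mem hconn hgeod hS hev hρ hV hm (hX.mono hVU)
        (fun y hy => hXi y (hVU hy)) hxV
    · rw [if_neg (xi_notMem_of_ne hev him (hm x hxV))]
      refine nabla_self_eq_of_flat hconn hgeod hS hev hρ hV him hm (hX.mono hVU)
        (fun y hy => hXi y (hVU hy)) hxV ?_ ?_ ?_
      · rw [← flat_xi_right, flat_eigenMeanCurvature hS hev (hm x hxV), eta_xi]
        simp
      · intro w hw
        rw [flat_eigenMeanCurvature hS hev hw,
          eta_of_mem_screen (hS.mem_screen hev him (hm x hxV) hw)]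
        simp
      · intro j hji w hw hws
        rw [flat_eigenMeanCurvature hS hev hw, eta_of_mem_screen hws, if_pos hji]
        ring

/-- The mean curvature vector field when the radical distribution is an eigenspace distribution. -/
theorem eigenMeanCurvature_eq (hS : L.IsATensor conn S) (hev : IsEigenfunctions S ev)
    {i m : Fin (k + 1)} (him : i ≠ m) (hrad : eigenDistribution S (ev m) x = radical L.gb L.f x) :
    L.eigenMeanCurvature S ev ρ i x = -(1 / 2 : ℝ) • (∑ j with j ≠ m ∧ j ≠ i,
        L.proj x (eigenDistribution S (ev j) x) (L.grad (fun y => Real.log |ev i y - ev j y|) x))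
      + ρ x • L.ξ x := by
  have hm : L.ξ x ∈ eigenDistribution S (ev m) x := hrad ▸ L.ξ_mem_radical x
  -- Projection onto the radical is `v ↦ η(v) ξ`. It kills the summand with index `m`, whose
  -- argument has had its `ξ` component removed.
  have hz : ∀ v : TangentSpace (𝓡 (n + 1)) x, L.η x v = 0 →
      spectralProjection S ev m x v = 0 := by
    intro v hv
    have hmem := (hS.sum_spectralProjection hev x v).1 m
    rw [hrad] at hmem
    obtain ⟨c, hc⟩ := exists_smul_xi_of_mem_radical hmem
    have h := hS.flat_spectralProjection hev v hm
    rw [← hc, flat_xi_right, flat_xi_right, eta_smul, eta_xi, hv, mul_one] at h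
    rw [← hc, h, zero_smul]
  rw [eigenMeanCurvature]
  congr 2
  have hfilter : (Finset.univ.filter fun j => j ≠ m ∧ j ≠ i)
      = (Finset.univ.filter fun j => j ≠ i).erase m := by
    ext j
    simp
  rw [hfilter, ← Finset.add_sum_erase _ _ (Finset.mem_filter.2 ⟨Finset.mem_univ m, him.symm⟩),
    hz, zero_add]
  · refine Finset.sum_congr rfl fun j hj => ?_
    rw [hS.proj_eq hev]
    -- For the other indices the subtraction is invisible, since `ξ` lies in the eigenspace of `ev
    -- m`.
    have hsub : ∀ (v : TangentSpace (𝓡 (n + 1)) x) (c : ℝ), spectralProjection S ev j x (v - c • L.ξ x)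
        = spectralProjection S ev j x v := by
      intro v c
      have h := lagrangeProduct_add (S := S) (ev := ev) j x (Finset.univ.erase j).toList
        (v - c • L.ξ x) (c • L.ξ x)
      rw [sub_add_cancel] at h
      have h0 : lagrangeProduct S ev j x (Finset.univ.erase j).toList (c • L.ξ x) = 0 :=
        spectralProjection_of_mem_ne (Finset.ne_of_mem_erase hj).symm
          (Submodule.smul_mem _ c hm)
      rw [h0, add_zero] at h
      exact h.symm
    exact hsub _ _
  · rw [← flat_xi_right, flat_sub_left, flat_grad, flat_smul_left, flat_xi_right, eta_xi]
    ring

end LightlikeHypersurface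
end Hypersurface
end LightlikeGeometry

/-! ### Assembly of the result -/

theorem proposition6p1 {n k : ℕ}
    {N : Type*} [TopologicalSpace N] [ChartedSpace (LightlikeGeometry.Model (n + 2)) N]
    [IsManifold (𝓡 (n + 2)) ∞ N]
    {M : Type*} [TopologicalSpace M] [ChartedSpace (LightlikeGeometry.Model (n + 1)) M]
    [IsManifold (𝓡 (n + 1)) ∞ M]
    (L : LightlikeGeometry.LightlikeHypersurface n N M)
    (conn : LightlikeGeometry.Connection (n + 2) N)
    (hconn : LightlikeGeometry.IsLeviCivita L.gb conn)
    (hgeod : L.IsTotallyGeodesic conn)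
    (S : ∀ x : M, TangentSpace (𝓡 (n + 1)) x →L[ℝ] TangentSpace (𝓡 (n + 1)) x)
    (hS : L.IsATensor conn S)
    (ev : Fin (k + 1) → M → ℝ)
    (hev : LightlikeGeometry.IsEigenfunctions S ev)
    (humb : L.ScreenTotallyUmbilical conn) :
    (∀ a, L.IsUmbilical conn (LightlikeGeometry.eigenDistribution S (ev a))) ∧
    ∃ ρ : M → ℝ, ContMDiff (𝓡 (n + 1)) 𝓘(ℝ, ℝ) ∞ ρ ∧
      L.ScreenUmbilicOn conn ρ Set.univ ∧
      ((∀ x, LightlikeGeometry.eigenDistribution S (ev 0) x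
          = LightlikeGeometry.radical L.gb L.f x) →
        ∀ i, i ≠ 0 →
          L.IsMeanCurvature conn (LightlikeGeometry.eigenDistribution S (ev i))
            (fun x => -(1 / 2 : ℝ) • (∑ j with j ≠ 0 ∧ j ≠ i,
                L.proj x (LightlikeGeometry.eigenDistribution S (ev j) x)
                  (L.grad (fun y => Real.log |ev i y - ev j y|) x))
              + ρ x • L.ξ x)) := by
  obtain ⟨ρ, hρs, hρ⟩ := LightlikeGeometry.LightlikeHypersurface.exists_global_umbilicity_factor humb
  have hmean := LightlikeGeometry.LightlikeHypersurface.isMeanCurvature_eigenDistribution hconn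
    hgeod hS hev hρs hρ
  refine ⟨fun a => ⟨_, hmean a⟩, ρ, hρs, hρ, fun hrad i hi => ?_⟩
  convert hmean i using 1
  funext x
  -- When the radical is the eigenspace of `ev 0`, `ξ` never lies in another one, so the glued field
  -- is given by its second case everywhere.
  rw [if_neg (LightlikeGeometry.LightlikeHypersurface.xi_notMem_of_ne hev hi
    ((hrad x).symm ▸ L.ξ_mem_radical x)),
    LightlikeGeometry.LightlikeHypersurface.eigenMeanCurvature_eq hS hev hi (hrad x)]
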